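/- Fix an inverse temperature $\beta>0$. Let $\rho$ and $\sigma$ be states (density matrices) of an $n$-level system with Hamiltonian $H_S=\sum_{i=1}^n E_i|i\rangle\langle i|$ and partition function $Z_S=\sum_i e^{-\beta E_i}$. *Thermal operations.* $\rho\xrightarrow{\mathrm{TO}}\sigma$ means that $\sigma$ equals, or is a limit of, states of the form $\operatorname{tr}_B[U(\rho\otimes\tau_B)U^\dagger]$, where $\tau_B$ is the Gibbs state at inverse temperature $\beta$ of a finite-dimensional bath with Hamiltonian $H_B$, and $U$ is a unitary commuting with $H_S\otimes\mathbb I+\mathbb I\otimes H_B$. *Thermo-majorization curve.* Remove from $\rho$ the coherences between distinct energies and let $\eta_i$ be the eigenvalues of the resulting block-diagonal state along an eigenbasis shared with $H_S$, $\eta_i$ belonging to energy $E_i$. List the levels so that $\eta_ie^{\beta E_i}$ is non-increasing. The curve of $\rho$ is obtained by joining by line segments the point $(0,0)$ and the successive points $\bigl(\sum_{i\le k}e^{-\beta E_i},\sum_{i\le k}\eta_i\bigr)$, $k=1,\dots,n$. *Coarse Operations.* These are: (1) appending a single two-level ancilla, with a given Hamiltonian $H_A$, in its Gibbs state; (2)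 Partial Level Thermalizations $\mathrm{PLT}_{\mathcal P}(\lambda)$, $\lambda\in[0,1]$, which replace $\eta_i$ by $(1-\lambda)\eta_i+\lambda\frac{e^{-\beta E_i}}{\sum_{l\in\mathcal P}e^{-\beta E_l}}\sum_{l\in\mathcal P}\eta_l$ for $i\in\mathcal P$; (3) Level Transformations $E_i\mapsto E_i+h_i$, which leave the state unchanged and spend the work $h_i$ when the system is in level $i$; (4) discarding the ancilla; (5) (random) unitaries on the system commuting with its Hamiltonian. PLTs and Level Transformations act on diagonal states $\sum_i\eta_i|i\rangle\langle i|$. The $t$-step Partial Isothermal Reversible Process $\mathrm{PITR}_{j,k}(\kappa)$, $j\neq k$, $\kappa>0$, consists of $\mathrm{PLT}_{\{j,k\}}(1)$ followed by $t$ rounds, each being a Level Transformation and then $\mathrm{PLT}_{\{j,k\}}(1)$; after round $r$ the levels are $E_j+r\kappa/t$ and $-\frac1\beta\ln\bigl[e^{-\beta E_k}+e^{-\beta E_j}(1-e^{-\beta r\kappa/t})\bigr]$, the others being unchanged. **Theorem.** Suppose that 1. $\sigma$ is block-diagonal in the energy eigenbasis (commutes with $H_S$); 2. $\rho\xrightarrow{\mathrm{TO}}\sigma$;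 3. the thermo-majorization curves of $\rho$ and $\sigma$ meet only at $(0,0)$ and $(Z_S,1)$. Then, for every ancilla Hamiltonian $H_A$, $(\rho,H_S)$ can be converted into $(\sigma,H_S)$ by Coarse Operations without expending any work and without raising an energy level to infinity. Precisely: there are a finite protocol, consisting of appending and discarding the ancilla, (random) energy-conserving unitaries on the system, PLTs, and PITRs (thus including Approximate Points Flows, each of which is a composition of a PITR, a PLT and a PITR), and a constant $M$ such that, when every PITR is performed in $t$ steps, for every $t\ge1$ the protocol takes $(\rho,H_S)$ exactly to $(\sigma,H_S)$ and all energy levels occurring in it stay in $[-M,M]$, while as $t\to\infty$ the total work $W_t$ spent satisfies $\langle W_t\rangle\to0$, $\operatorname{Var}(W_t)\to0$ and $P(|W_t|\ge\varepsilon)\to0$ for every $\varepsilon>0$. -/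

import Mathlib

open scoped Matrix Kronecker ComplexOrder

noncomputable section

namespace Thermo

/-! ### States, Hamiltonians, thermal operations -/

/-- The Hamiltonian `∑ i, E i |i⟩⟨i|`. -/
def hamiltonian {ι : Type} [DecidableEq ι] (E : ι → ℝ) : Matrix ι ι ℂ :=
  Matrix.diagonal fun i => (E i : ℂ)

/-- A quantum state (density matrix). -/
def IsState {ι : Type} [Fintype ι] (ρ : Matrix ι ι ℂ) : Prop :=
  ρ.PosSemidef ∧ ρ.trace = 1

/-- Block-diagonal in the energy eigenbasis: commuting with the Hamiltonian. -/
def IsBlockDiagonal {ι : Type} [Fintype ι] [DecidableEq ι] (E : ι → ℝ)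
    (ρ : Matrix ι ι ℂ) : Prop :=
  Commute ρ (hamiltonian E)

/-- The partition function `∑ i, exp (-β E i)`. -/
def partition {ι : Type} [Fintype ι] (β : ℝ) (E : ι → ℝ) : ℝ :=
  ∑ i, Real.exp (-β * E i)

/-- The Gibbs state of `∑ i, E i |i⟩⟨i|` at inverse temperature `β`. -/
def gibbs {ι : Type} [Fintype ι] [DecidableEq ι] (β : ℝ) (E : ι → ℝ) : Matrix ι ι ℂ :=
  Matrix.diagonal fun i => ((Real.exp (-β * E i) / partition β E : ℝ) : ℂ)

/-- The partial trace over the second tensor factor. -/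
def partialTrace {ι κ : Type} [Fintype κ] (X : Matrix (ι × κ) (ι × κ) ℂ) : Matrix ι ι ℂ :=
  Matrix.of fun i j => ∑ s, X (i, s) (j, s)

/-- The outputs `tr_B [U (ρ ⊗ τ_B) U†]` for all finite-dimensional baths `B` with Hamiltonian
`H_B = ∑ s, F s |s⟩⟨s|` in its Gibbs state and all unitaries `U` commuting with `H_S + H_B`. -/
def thermalOutputs {n : ℕ} (β : ℝ) (E : Fin n → ℝ) (ρ : Matrix (Fin n) (Fin n) ℂ) :
    Set (Matrix (Fin n) (Fin n) ℂ) :=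
  {X | ∃ (m : ℕ) (F : Fin m → ℝ) (U : Matrix (Fin n × Fin m) (Fin n × Fin m) ℂ),
    0 < m ∧ U ∈ Matrix.unitaryGroup (Fin n × Fin m) ℂ ∧
    Commute U (hamiltonian E ⊗ₖ (1 : Matrix (Fin m) (Fin m) ℂ) +
      (1 : Matrix (Fin n) (Fin n) ℂ) ⊗ₖ hamiltonian F) ∧
    X = partialTrace (U * (ρ ⊗ₖ gibbs β F) * Uᴴ)}

/-- `ρ` can be transformed into `σ` by thermal operations, exactly or to any desired accuracy. -/
def ThermalConvertible {n : ℕ} (β : ℝ) (E : Fin n → ℝ) (ρ σ : Matrix (Fin n) (Fin n) ℂ) : Prop :=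
  σ ∈ closure (thermalOutputs β E ρ)

/-! ### Thermo-majorization curves -/

/-- `π` is a `β`-ordering: it lists the levels with `η i * exp (β E i)` non-increasing. -/
def IsBetaOrder {n : ℕ} (β : ℝ) (E η : Fin n → ℝ) (π : Equiv.Perm (Fin n)) : Prop :=
  Antitone fun i => η (π i) * Real.exp (β * E (π i))

/-- The point of the diagram reached after the first `k` of the levels listed by `π`. -/
def curvePoint {n : ℕ} (β : ℝ) (E η : Fin n → ℝ) (π : Equiv.Perm (Fin n)) (k : ℕ) : ℝ × ℝ :=
  (∑ i : Fin n with i.val < k, Real.exp (-β * E (π i)), ∑ i : Fin n with i.val < k, η (π i))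

/-- The thermo-majorization curve of the diagonal state `∑ i, η i |i⟩⟨i|`: the `β`-ordered points
joined by line segments. All `β`-orderings give the same curve, since tied levels give
collinear points. -/
def diagonalCurve {n : ℕ} (β : ℝ) (E η : Fin n → ℝ) : Set (ℝ × ℝ) :=
  {p | ∃ π : Equiv.Perm (Fin n), IsBetaOrder β E η π ∧
    ∃ k < n, p ∈ segment ℝ (curvePoint β E η π k) (curvePoint β E η π (k + 1))}

/-- The state decohered in the energy eigenbasis: the coherences between distinct energies are
removed. -/
def decohere {n : ℕ} (E : Fin n → ℝ) (ρ : Matrix (Fin n) (Fin n) ℂ) :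
    Matrix (Fin n) (Fin n) ℂ :=
  Matrix.of fun i j => if E i = E j then ρ i j else 0

/-- `η` lists the eigenvalues of the decohered state along an orthonormal eigenbasis that it shares
with the Hamiltonian, `η i` belonging to an eigenvector of energy `E i`. -/
def IsPopulation {n : ℕ} (E : Fin n → ℝ) (ρ : Matrix (Fin n) (Fin n) ℂ) (η : Fin n → ℝ) : Prop :=
  ∃ V ∈ Matrix.unitaryGroup (Fin n) ℂ, Commute V (hamiltonian E) ∧
    decohere E ρ = V * Matrix.diagonal (fun i => (η i : ℂ)) * Vᴴ

/-- The thermo-majorization curve of a state. Different choices of `η` differ only by a permutation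
of levels of equal energy, and so give the same curve. -/
def thermoCurve {n : ℕ} (β : ℝ) (E : Fin n → ℝ) (ρ : Matrix (Fin n) (Fin n) ℂ) : Set (ℝ × ℝ) :=
  {p | ∃ η, IsPopulation E ρ η ∧ p ∈ diagonalCurve β E η}

/-! ### Coarse Operations, with the work recorded -/

/-- A system together with a record of the work spent on it so far: `branch w` is the unnormalised
state of the system on the event that the total work spent so far is `w`. -/
structure Config (ι : Type) where
  /-- The current energy levels. -/
  energy : ι → ℝ
  /-- The branches of the joint state of system and work record. -/
  branch : ℝ →₀ Matrix ι ι ℂ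

namespace Config

variable {ι : Type}

/-- The state of the system. -/
def state (c : Config ι) : Matrix ι ι ℂ := c.branch.sum fun _ X => X

/-- All branches are diagonal, `∑ i, η i |i⟩⟨i|`. -/
def IsDiagonal (c : Config ι) : Prop := ∀ w, (c.branch w).IsDiag

/-- The probability that the total work spent is `w`. -/
def workProb [Fintype ι] (c : Config ι) (w : ℝ) : ℝ := (c.branch w).trace.re

/-- The expectation of the work spent. -/
def workMean [Fintype ι] (c : Config ι) : ℝ := ∑ w ∈ c.branch.support, w * c.workProb w

/-- The variance of the work spent. -/
def workVariance [Fintype ι] (c : Config ι) : ℝ :=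
  ∑ w ∈ c.branch.support, (w - c.workMean) ^ 2 * c.workProb w

/-- The probability that the work spent is at least `ε` in absolute value. -/
def workTail [Fintype ι] (c : Config ι) (ε : ℝ) : ℝ :=
  ∑ w ∈ c.branch.support with ε ≤ |w|, c.workProb w

/-- The system `(ρ, E)` before any work is spent. -/
def start (E : ι → ℝ) (ρ : Matrix ι ι ℂ) : Config ι where
  energy := E
  branch := Finsupp.single 0 ρ

end Config

/-- `ρ ↦ ∑ k, p k • U k ρ (U k)†`. -/
def mixUnitary {ι : Type} [Fintype ι] {m : ℕ} (p : Fin m → ℝ) (U : Fin m → Matrix ι ι ℂ)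
    (X : Matrix ι ι ℂ) : Matrix ι ι ℂ :=
  ∑ k, (p k : ℂ) • (U k * X * (U k)ᴴ)

/-- The action of the Partial Level Thermalization over the levels `P` with parameter `lam` on
a diagonal matrix. -/
def thermalize {ι : Type} [DecidableEq ι] (β : ℝ) (E : ι → ℝ) (P : Finset ι) (lam : ℝ)
    (X : Matrix ι ι ℂ) : Matrix ι ι ℂ :=
  Matrix.diagonal fun i =>
    if i ∈ P then
      (1 - (lam : ℂ)) * X i i +
        ((lam * Real.exp (-β * E i) / ∑ l ∈ P, Real.exp (-β * E l) : ℝ) : ℂ) * ∑ l ∈ P, X l l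
    else X i i

/-- The Coarse Operations that keep the set of levels: a random energy-conserving unitary,
a Partial Level Thermalization, and a Level Transformation `E i ↦ E i + h i`. -/
inductive CoarseOp (ι : Type) : Type where
  | unitary (m : ℕ) (p : Fin m → ℝ) (U : Fin m → Matrix ι ι ℂ) : CoarseOp ι
  | plt (P : Finset ι) (lam : ℝ) : CoarseOp ι
  | lt (h : ι → ℝ) : CoarseOp ι

namespace CoarseOp

variable {ι : Type} [Fintype ι] [DecidableEq ι]

/-- The conditions under which an operation may be applied. Partial Level Thermalizations and Level
Transformations are defined on diagonal states only. -/
def Allowed : CoarseOp ι → Config ι → Prop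
  | unitary _ p U, c => (∀ k, 0 ≤ p k) ∧ ∑ k, p k = 1 ∧
      ∀ k, U k ∈ Matrix.unitaryGroup ι ℂ ∧ Commute (U k) (hamiltonian c.energy)
  | plt _ lam, c => 0 ≤ lam ∧ lam ≤ 1 ∧ c.IsDiagonal
  | lt _, c => c.IsDiagonal

/-- The effect of an operation. A Level Transformation leaves the state as it is, and spends
the work `h i` if the system is in level `i`. -/
def apply (β : ℝ) : CoarseOp ι → Config ι → Config ι
  | unitary _ p U, c =>
      { energy := c.energy
        branch := c.branch.mapRange (mixUnitary p U) (by simp [mixUnitary]) }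
  | plt P lam, c =>
      { energy := c.energy
        branch := c.branch.mapRange (thermalize β c.energy P lam) (by simp [thermalize]) }
  | lt h, c =>
      { energy := fun i => c.energy i + h i
        branch := c.branch.sum fun w X =>
          ∑ i, Finsupp.single (w + h i) (Matrix.single i i (X i i)) }

/-- `Runs β M ops c c'`: the operations `ops` can be applied in turn, they take `c` to `c'`, and no
energy level ever exceeds `M` in absolute value. -/
def Runs (β M : ℝ) : List (CoarseOp ι) → Config ι → Config ι → Prop
  | [], c, c' => (∀ i, |c.energy i| ≤ M) ∧ c' = c
  | o :: ops, c, c' => (∀ i, |c.energy i| ≤ M) ∧ o.Allowed c ∧ Runs β M ops (o.apply β c) c'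

end CoarseOp

/-- Appending a two-level ancilla with energies `a` in its Gibbs state. -/
def appendAncilla {ι : Type} (β : ℝ) (a : Fin 2 → ℝ) (c : Config ι) : Config (ι × Fin 2) where
  energy := fun x => c.energy x.1 + a x.2
  branch := c.branch.mapRange (fun X => X ⊗ₖ gibbs β a) (by simp)

/-- `c'` is obtained from `c` by discarding the ancilla, the joint Hamiltonian being
`H_S + H_A` with the original `H_A`. -/
def DiscardsAncilla {ι : Type} (a : Fin 2 → ℝ) (c : Config (ι × Fin 2)) (c' : Config ι) : Prop :=
  (∀ i s, c.energy (i, s) = c'.energy i + a s) ∧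
    c'.branch = c.branch.mapRange partialTrace (by ext; simp [partialTrace])

/-! ### Partial Isothermal Reversible Processes and protocols -/

/-- The energy levels after a Partial Isothermal Reversible Process on the levels `j`, `k` with
parameter `κ`. -/
def pitrEnergy {ι : Type} [DecidableEq ι] (β : ℝ) (j k : ι) (κ : ℝ) (E : ι → ℝ) : ι → ℝ :=
  fun i =>
    if i = j then E j + κ
    else if i = k then
      -(1 / β) * Real.log (Real.exp (-β * E k) + Real.exp (-β * E j) * (1 - Real.exp (-β * κ)))
    else E i

/-- The Coarse Operations performing a Partial Isothermal Reversible Process in `t` steps: `j`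
and `k` are thermalized, and then every step is a Level Transformation, raising level `j` by
`κ / t`, followed by a full thermalization of `j` and `k`. -/
def pitrOps {ι : Type} [DecidableEq ι] (β : ℝ) (t : ℕ) (j k : ι) (κ : ℝ) (E : ι → ℝ) :
    List (CoarseOp ι) :=
  CoarseOp.plt {j, k} 1 :: (List.range t).flatMap fun r =>
    [CoarseOp.lt fun i =>
      pitrEnergy β j k ((r + 1 : ℕ) * κ / t) E i - pitrEnergy β j k ((r : ℕ) * κ / t) E i,
     CoarseOp.plt {j, k} 1]

/-- The instructions of a protocol: random energy-conserving unitaries, Partial Level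
Thermalizations and Partial Isothermal Reversible Processes. -/
inductive Instr (ι : Type) : Type where
  | unitary (m : ℕ) (p : Fin m → ℝ) (U : Fin m → Matrix ι ι ℂ) : Instr ι
  | plt (P : Finset ι) (lam : ℝ) : Instr ι
  | pitr (j k : ι) (κ : ℝ) : Instr ι

namespace Instr

variable {ι : Type} [DecidableEq ι]

/-- A Partial Isothermal Reversible Process acts on two different levels, with positive `κ`. -/
def Valid : Instr ι → Prop
  | pitr j k κ => j ≠ k ∧ 0 < κ
  | _ => True

/-- The instruction is not a unitary. -/
def IsLevelInstr : Instr ι → Prop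
  | unitary _ _ _ => False
  | _ => True

/-- The list of Coarse Operations that carries out a list of instructions on a system with energy
levels `E`, every Partial Isothermal Reversible Process being performed in `t` steps. -/
def compile (β : ℝ) (t : ℕ) : (ι → ℝ) → List (Instr ι) → List (CoarseOp ι)
  | _, [] => []
  | E, unitary m p U :: l => CoarseOp.unitary m p U :: compile β t E l
  | E, plt P lam :: l => CoarseOp.plt P lam :: compile β t E l
  | E, pitr j k κ :: l => pitrOps β t j k κ E ++ compile β t (pitrEnergy β j k κ E) l

/-- Carrying out the instructions `l` in this way takes `c` to `c'`, while no energy level ever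
exceeds `M` in absolute value. -/
def Executes [Fintype ι] (β M : ℝ) (t : ℕ) (l : List (Instr ι)) (c c' : Config ι) : Prop :=
  CoarseOp.Runs β M (compile β t c.energy l) c c'

end Instr

/-- A protocol for an `n`-level system: instructions for the system, instructions for the system
with the ancilla appended, and instructions for the system after the ancilla is discarded.
Unitaries act on the system alone. -/
structure Protocol (n : ℕ) where
  pre : List (Instr (Fin n))
  mid : List (Instr (Fin n × Fin 2))
  post : List (Instr (Fin n))
  pre_valid : ∀ I ∈ pre, I.Valid
  mid_valid : ∀ I ∈ mid, I.Valid ∧ I.IsLevelInstr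
  post_valid : ∀ I ∈ post, I.Valid

/-- The protocol, with an ancilla of energies `a` and `t`-step Partial Isothermal Reversible
Processes, takes `c` to `c'`, while no energy level ever exceeds `M` in absolute value. -/
def Protocol.Performs {n : ℕ} (Q : Protocol n) (β : ℝ) (a : Fin 2 → ℝ) (M : ℝ) (t : ℕ)
    (c c' : Config (Fin n)) : Prop :=
  ∃ (c₁ c₃ : Config (Fin n)) (c₂ : Config (Fin n × Fin 2)),
    Instr.Executes β M t Q.pre c c₁ ∧
    Instr.Executes β M t Q.mid (appendAncilla β a c₁) c₂ ∧
    DiscardsAncilla a c₂ c₃ ∧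
    Instr.Executes β M t Q.post c₃ c'

/-- `(ρ, E)` can be converted into `(σ, E)` by Coarse Operations, with an ancilla of energies `a`,
without expending work and without raising an energy level to infinity: there are a finite
protocol and a bound `M` such that, whatever the number `t` of steps spent on each Partial
Isothermal Reversible Process, the protocol takes `ρ` exactly to `σ`, restores the Hamiltonian and
keeps all energy levels in `[-M, M]`, while the distribution of the work spent concentrates at
zero as `t → ∞`. -/
def CoarseConvertibleFree {n : ℕ} (β : ℝ) (a : Fin 2 → ℝ) (E : Fin n → ℝ)
    (ρ σ : Matrix (Fin n) (Fin n) ℂ) : Prop :=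
  ∃ (Q : Protocol n) (M : ℝ) (c : ℕ → Config (Fin n)),
    (∀ t, 1 ≤ t →
      Q.Performs β a M t (Config.start E ρ) (c t) ∧ (c t).energy = E ∧ (c t).state = σ) ∧
    Filter.Tendsto (fun t => (c t).workMean) Filter.atTop (nhds 0) ∧
    Filter.Tendsto (fun t => (c t).workVariance) Filter.atTop (nhds 0) ∧
    ∀ ε : ℝ, 0 < ε → Filter.Tendsto (fun t => (c t).workTail ε) Filter.atTop (nhds 0)

end Thermo

end

/-! Thermal convertibility forces the curve of `ρ` to lie nowhere below the elbows of the curve of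
`σ`. In energy eigenbases the populations evolve by a stochastic matrix that preserves Boltzmann
weights, and by Jensen such a matrix cannot increase `excess`, the Legendre dual of the curve
(`ThermalConvertible.excess_le`). Since the curves meet only at their ends, the inequality is strict
at the inner elbows of `σ` (`cum_lt_curveHeight`). There are finitely many of these, so populations
whose elbows merely approximate the curve of `ρ` still dominate `σ`, and the remaining gap is closed
exactly by two-level thermalizations (`steers_of_cum_le`).

The approximation comes from one primitive. A Partial Isothermal Reversible Process conserves the
joint Boltzmann weight of two levels, redistributes it, and shares their population in the same
ratio (`Steers.split`). With the ancilla every system level becomes a pair of levels, so levels of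
tiny weight `δ` can be produced. One of them serves as carrier: weight and its proportional
population pass through it from any level to any other, with an error that vanishes as `δ → 0`
(`Approaches.transfer`). Thus every transport plan between levels is carried out to any accuracy and
the Hamiltonian is restored (`exists_steers_transport`). The plan used is the monotone coupling of
the two orderings, whose cumulative sums are heights of the curve of `ρ` (`exists_transport`). A
positive `δ` is fixed before `t`, so energies stay bounded and the final state is exact.

The work is controlled by its first two moments, resolved by level. In one of `t` isothermal steps
the first-order mean work cancels, so the accumulated mean and second moment are `O(1/t)`
(`exists_round_moment_bounds`); Chebyshev's inequality gives the tails. Random phases and a rotation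
make `ρ` diagonal beforehand, and a final rotation produces `σ` without touching the work record. -/

noncomputable section

namespace Thermo

open Filter Topology

/-! ### Level-resolved work moments under single operations, and composable steering. -/

section

variable {ι : Type}

namespace Config

/-- The expectation of `f` of the work spent, on the event that the system is in level `x`. -/
def avg (c : Config ι) (f : ℝ → ℝ) (x : ι) : ℝ := c.branch.sum fun w X => f w * (X x x).re

theorem avg_add (c : Config ι) (f g : ℝ → ℝ) (x : ι) :
    c.avg (fun w => f w + g w) x = c.avg f x + c.avg g x := by
  simp only [avg, Finsupp.sum, add_mul, Finset.sum_add_distrib]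

theorem avg_const_mul (c : Config ι) (r : ℝ) (f : ℝ → ℝ) (x : ι) :
    c.avg (fun w => r * f w) x = r * c.avg f x := by
  simp only [avg, Finsupp.sum, mul_assoc, Finset.mul_sum]

theorem avg_one (c : Config ι) (x : ι) : c.avg (fun _ => 1) x = (c.state x x).re := by
  simp [avg, state, Finsupp.sum, Matrix.sum_apply]

theorem sum_support_workProb [Fintype ι] (c : Config ι) (f : ℝ → ℝ) :
    ∑ w ∈ c.branch.support, f w * c.workProb w = ∑ x, c.avg f x := by
  simp only [avg, Finsupp.sum, workProb, Matrix.trace, Matrix.diag, Complex.re_sum, Finset.mul_sum]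
  exact Finset.sum_comm

end Config

/-- All branches of `c` are diagonal with nonnegative work distributions in every level, the energy
levels are `E`, and the state is `∑ i, p i |i⟩⟨i|`. -/
structure IsClassical [DecidableEq ι] (E p : ι → ℝ) (c : Config ι) : Prop where
  energy_eq : c.energy = E
  diag : c.IsDiagonal
  avg_nonneg : ∀ f : ℝ → ℝ, (∀ w, 0 ≤ f w) → ∀ x, 0 ≤ c.avg f x
  state_eq : c.state = Matrix.diagonal fun i => (p i : ℂ)

theorem IsClassical.avg_one [DecidableEq ι] {E p : ι → ℝ} {c : Config ι}
    (h : IsClassical E p c) (x : ι) : c.avg (fun _ => 1) x = p x := by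
  simp [Config.avg_one, h.state_eq]

/-- The populations after a Partial Level Thermalization. -/
def thermalizePop [DecidableEq ι] (β : ℝ) (E : ι → ℝ) (P : Finset ι) (lam : ℝ) (p : ι → ℝ) : ι → ℝ :=
  fun i => if i ∈ P then
      (1 - lam) * p i + lam * Real.exp (-β * E i) / (∑ l ∈ P, Real.exp (-β * E l)) * ∑ l ∈ P, p l
    else p i

theorem thermalizePop_nonneg [DecidableEq ι] {β : ℝ} {E : ι → ℝ} {P : Finset ι} {lam : ℝ} {p : ι → ℝ}
    (h0 : 0 ≤ lam) (h1 : lam ≤ 1) (hp : ∀ x, 0 ≤ p x) (x : ι) :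
    0 ≤ thermalizePop β E P lam p x := by
  unfold thermalizePop
  split_ifs
  · have := sub_nonneg.2 h1
    have h2 := Finset.sum_nonneg fun l (_ : l ∈ P) => hp l
    have h3 := hp x
    positivity
  · exact hp x

theorem tendsto_thermalizePop_zero [DecidableEq ι] (β : ℝ) (E : ι → ℝ) (P : Finset ι) (lam : ℝ) {f : ℕ → ι → ℝ}
    (hf : ∀ x, Tendsto (fun t => f t x) atTop (𝓝 0)) (x : ι) :
    Tendsto (fun t => thermalizePop β E P lam (f t) x) atTop (𝓝 0) := by
  unfold thermalizePop
  split_ifs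
  · have h := ((hf x).const_mul (1 - lam)).add
      ((tendsto_finsetSum P fun l _ => hf l).const_mul
        (lam * Real.exp (-β * E x) / (∑ l ∈ P, Real.exp (-β * E l))))
    simpa using h
  · exact hf x

namespace Instr

variable [DecidableEq ι]

/-- The energy levels after the instructions `l`. -/
def finalEnergy (β : ℝ) : (ι → ℝ) → List (Instr ι) → ι → ℝ
  | E, [] => E
  | E, unitary _ _ _ :: l => finalEnergy β E l
  | E, plt _ _ :: l => finalEnergy β E l
  | E, pitr j k κ :: l => finalEnergy β (pitrEnergy β j k κ E) l

theorem compile_append (β : ℝ) (t : ℕ) (E : ι → ℝ) (l l' : List (Instr ι)) :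
    compile β t E (l ++ l') = compile β t E l ++ compile β t (finalEnergy β E l) l' := by
  induction l generalizing E with
  | nil => rfl
  | cons I l ih => cases I <;> simp [compile, finalEnergy, ih]

theorem finalEnergy_append (β : ℝ) (E : ι → ℝ) (l l' : List (Instr ι)) :
    finalEnergy β E (l ++ l') = finalEnergy β (finalEnergy β E l) l' := by
  induction l generalizing E with
  | nil => rfl
  | cons I l ih => cases I <;> simp [finalEnergy, ih]

end Instr

theorem thermalizePop_sum [DecidableEq ι] (β : ℝ) (E : ι → ℝ) (P : Finset ι) (lam : ℝ) (p : ι → ℝ) :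
    ∑ i ∈ P, thermalizePop β E P lam p i = ∑ i ∈ P, p i := by
  rcases P.eq_empty_or_nonempty with rfl | hP
  · simp
  have hpos : 0 < ∑ l ∈ P, Real.exp (-β * E l) := Finset.sum_pos (fun _ _ => Real.exp_pos _) hP
  have : ∀ i ∈ P, thermalizePop β E P lam p i = (1 - lam) * p i +
      Real.exp (-β * E i) * (lam / (∑ l ∈ P, Real.exp (-β * E l)) * ∑ l ∈ P, p l) := by
    intro i hi
    rw [thermalizePop, if_pos hi]
    ring
  rw [Finset.sum_congr rfl this, Finset.sum_add_distrib, ← Finset.mul_sum, ← Finset.sum_mul]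
  field_simp
  ring

section
variable [Fintype ι] [DecidableEq ι]

/-- A thermalization acts linearly on each branch and leaves the work label alone. Hence all
level-resolved moments evolve by the same linear map as the populations. -/
theorem avg_plt (β : ℝ) (P : Finset ι) (lam : ℝ) (c : Config ι) (f : ℝ → ℝ) :
    ((CoarseOp.plt P lam).apply β c).avg f = thermalizePop β c.energy P lam (c.avg f) := by
  ext x
  simp only [CoarseOp.apply, Config.avg, thermalizePop]
  rw [Finsupp.sum_mapRange_index (by simp)]
  split_ifs with hx
  · simp only [thermalize, Matrix.diagonal_apply_eq, if_pos hx, Finsupp.sum]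
    rw [Finset.sum_comm (s := P), Finset.mul_sum, Finset.mul_sum, ← Finset.sum_add_distrib]
    refine Finset.sum_congr rfl fun w _ => ?_
    have : ((1 - (lam : ℂ)) * c.branch w x x).re = (1 - lam) * (c.branch w x x).re := by
      rw [← Complex.ofReal_one, ← Complex.ofReal_sub, Complex.re_ofReal_mul]
    rw [Complex.add_re, this, Complex.re_ofReal_mul, Complex.re_sum, ← Finset.mul_sum]
    ring
  · simp only [thermalize, Matrix.diagonal_apply_eq, if_neg hx]

theorem state_plt (β : ℝ) (P : Finset ι) (lam : ℝ) (c : Config ι) :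
    ((CoarseOp.plt P lam).apply β c).state = thermalize β c.energy P lam c.state := by
  simp only [CoarseOp.apply, Config.state]
  rw [Finsupp.sum_mapRange_index (by simp)]
  ext i j
  rcases eq_or_ne i j with rfl | hij
  · simp only [thermalize, Finsupp.sum, Matrix.sum_apply, Matrix.diagonal_apply_eq]
    split_ifs
    · rw [Finset.sum_comm (s := P), Finset.mul_sum, Finset.mul_sum, ← Finset.sum_add_distrib]
    · rfl
  · simp [thermalize, Finsupp.sum, Matrix.sum_apply, hij]

theorem IsClassical.plt {E p : ι → ℝ} {c : Config ι} (h : IsClassical E p c) (β : ℝ)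
    (P : Finset ι) {lam : ℝ} (h0 : 0 ≤ lam) (h1 : lam ≤ 1) :
    IsClassical E (thermalizePop β E P lam p) ((CoarseOp.plt P lam).apply β c) where
  energy_eq := h.energy_eq
  diag w := by
    simp [CoarseOp.apply, thermalize, Matrix.isDiag_diagonal]
  avg_nonneg f hf x := by
    rw [avg_plt]
    exact thermalizePop_nonneg h0 h1 (h.avg_nonneg f hf) x
  state_eq := by
    rw [state_plt, h.state_eq, h.energy_eq]
    unfold thermalize
    congr 1
    ext i
    simp only [thermalizePop, Matrix.diagonal_apply_eq]
    split_ifs <;> push_cast <;> rfl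

/-- Only the work label moves, by an amount fixed by the level, so the moments of one level never
mix with those of another. -/
theorem avg_lt (β : ℝ) (h : ι → ℝ) (c : Config ι) (f : ℝ → ℝ) (x : ι) :
    ((CoarseOp.lt h).apply β c).avg f x = c.avg (fun w => f (w + h x)) x := by
  simp only [CoarseOp.apply, Config.avg]
  rw [Finsupp.sum_sum_index (by simp) (by intros; simp [mul_add])]
  refine Finset.sum_congr rfl fun w _ => ?_
  beta_reduce
  rw [← Finsupp.sum_finsetSum_index (by simp) (by intros; simp [mul_add])]
  rw [Finset.sum_eq_single x]
  · rw [Finsupp.sum_single_index (by simp)]; simp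
  · intro y _ hy
    rw [Finsupp.sum_single_index (by simp)]; simp [Matrix.single, hy]
  · simp

theorem IsClassical.lt {E p : ι → ℝ} {c : Config ι} (hc : IsClassical E p c) (β : ℝ) (h : ι → ℝ) :
    IsClassical (fun i => E i + h i) p ((CoarseOp.lt h).apply β c) where
  energy_eq := by simp [CoarseOp.apply, hc.energy_eq]
  diag w := by
    intro i j hij
    simp only [CoarseOp.apply, Finsupp.sum, Finsupp.coe_finsetSum, Finset.sum_apply, Matrix.sum_apply]
    refine Finset.sum_eq_zero fun v _ => Finset.sum_eq_zero fun k _ => ?_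
    rw [Finsupp.single_apply]
    split_ifs
    · rw [Matrix.single_apply, if_neg]
      rintro ⟨rfl, rfl⟩
      exact hij rfl
    · rfl
  avg_nonneg f hf x := by
    rw [avg_lt]
    exact hc.avg_nonneg _ (fun w => hf _) x
  state_eq := by
    rw [← hc.state_eq]
    simp only [CoarseOp.apply, Config.state]
    rw [Finsupp.sum_sum_index (by simp) (by simp)]
    refine Finset.sum_congr rfl fun w _ => ?_
    beta_reduce
    rw [← Finsupp.sum_finsetSum_index (by simp) (by simp)]
    simp only [Finsupp.sum_single_index]
    ext i j
    rw [Matrix.sum_apply]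
    rcases eq_or_ne i j with rfl | hij
    · simp [Matrix.single_apply]
    · rw [hc.diag w hij]
      refine Finset.sum_eq_zero fun k _ => ?_
      rw [Matrix.single_apply, if_neg]
      rintro ⟨rfl, rfl⟩
      exact hij rfl

theorem sum_thermalizePop (β : ℝ) (E : ι → ℝ) (P : Finset ι) (lam : ℝ) (p : ι → ℝ) :
    ∑ i, thermalizePop β E P lam p i = ∑ i, p i := by
  rw [← Finset.sum_add_sum_compl P, thermalizePop_sum, ← Finset.sum_add_sum_compl P p]
  congr 1
  refine Finset.sum_congr rfl fun i hi => ?_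
  rw [thermalizePop, if_neg (Finset.mem_compl.1 hi)]

namespace CoarseOp

theorem Runs.mono {β M M' : ℝ} (hM : M ≤ M') {l : List (CoarseOp ι)} {c c' : Config ι}
    (h : Runs β M l c c') : Runs β M' l c c' := by
  induction l generalizing c with
  | nil => exact ⟨fun i => (h.1 i).trans hM, h.2⟩
  | cons o l ih => exact ⟨fun i => (h.1 i).trans hM, h.2.1, ih h.2.2⟩

theorem Runs.append {β M : ℝ} {l l' : List (CoarseOp ι)} {c c' c'' : Config ι}
    (h : Runs β M l c c') (h' : Runs β M l' c' c'') : Runs β M (l ++ l') c c'' := by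
  induction l generalizing c with
  | nil => obtain ⟨_, rfl⟩ := h; exact h'
  | cons o l ih => exact ⟨h.1, h.2.1, ih h.2.2⟩

end CoarseOp

/-- A family of classical configurations whose work converges to zero in mean square. -/
structure WorkFree (E p : ι → ℝ) (c : ℕ → Config ι) : Prop where
  classical : ∀ t, 1 ≤ t → IsClassical E p (c t)
  mean : ∀ x, Tendsto (fun t => (c t).avg (fun w => w) x) atTop (𝓝 0)
  sq : ∀ x, Tendsto (fun t => (c t).avg (fun w => w ^ 2) x) atTop (𝓝 0)

/-- Partial Level Thermalizations and Partial Isothermal Reversible Processes take the populations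
`p` on the levels `E` to the populations `p'` on the levels `E'`, at asymptotically no work. -/
def Steers (β : ℝ) (E p E' p' : ι → ℝ) : Prop :=
  ∑ x, p' x = ∑ x, p x ∧
  ∃ l : List (Instr ι), (∀ I ∈ l, I.Valid ∧ I.IsLevelInstr) ∧ Instr.finalEnergy β E l = E' ∧
    ∀ c : ℕ → Config ι, WorkFree E p c → ∃ (M : ℝ) (c' : ℕ → Config ι), WorkFree E' p' c' ∧
      ∀ t, 1 ≤ t → Instr.Executes β M t l (c t) (c' t)

theorem Steers.refl (β : ℝ) (E p : ι → ℝ) : Steers β E p E p := by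
  refine ⟨rfl, [], by simp, rfl, fun c hc => ⟨∑ i, |E i|, c, hc, fun t ht => ⟨fun i => ?_, rfl⟩⟩⟩
  rw [(hc.classical t ht).energy_eq]
  exact Finset.single_le_sum (f := fun i => |E i|) (fun i _ => abs_nonneg _) (Finset.mem_univ i)

/-- Composition works because `Steers` fixes the instruction list before the family of
configurations and accepts every work-free family, however its work record is correlated with the
level. -/
theorem Steers.trans {β : ℝ} {E p E' p' E'' p'' : ι → ℝ} (h : Steers β E p E' p')
    (h' : Steers β E' p' E'' p'') : Steers β E p E'' p'' := by
  obtain ⟨hs, l, hl, hE, H⟩ := h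
  obtain ⟨hs', l', hl', hE', H'⟩ := h'
  refine ⟨hs'.trans hs, l ++ l', ?_, ?_, fun c hc => ?_⟩
  · intro I hI
    rcases List.mem_append.1 hI with hI | hI
    exacts [hl I hI, hl' I hI]
  · rw [Instr.finalEnergy_append, hE, hE']
  · obtain ⟨M, c', hc', hM⟩ := H c hc
    obtain ⟨M', c'', hc'', hM'⟩ := H' c' hc'
    refine ⟨max M M', c'', hc'', fun t ht => ?_⟩
    have h1 := (hM t ht).mono (le_max_left M M')
    have h2 := (hM' t ht).mono (le_max_right M M')
    unfold Instr.Executes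
    rw [Instr.compile_append, (hc.classical t ht).energy_eq, hE]
    rw [(hc.classical t ht).energy_eq] at h1
    rw [(hc'.classical t ht).energy_eq] at h2
    exact h1.append h2

theorem WorkFree.plt {E p : ι → ℝ} {c : ℕ → Config ι} (h : WorkFree E p c) (β : ℝ)
    (P : Finset ι) {lam : ℝ} (h0 : 0 ≤ lam) (h1 : lam ≤ 1) :
    WorkFree E (thermalizePop β E P lam p) (fun t => (CoarseOp.plt P lam).apply β (c t)) where
  classical t ht := (h.classical t ht).plt β P h0 h1
  mean x := by
    refine (tendsto_thermalizePop_zero β E P lam h.mean x).congr' ?_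
    filter_upwards [eventually_ge_atTop 1] with t ht
    rw [avg_plt, (h.classical t ht).energy_eq]
  sq x := by
    refine (tendsto_thermalizePop_zero β E P lam h.sq x).congr' ?_
    filter_upwards [eventually_ge_atTop 1] with t ht
    rw [avg_plt, (h.classical t ht).energy_eq]

theorem Steers.plt (β : ℝ) (E p : ι → ℝ) (P : Finset ι) {lam : ℝ} (h0 : 0 ≤ lam) (h1 : lam ≤ 1) :
    Steers β E p E (thermalizePop β E P lam p) := by
  refine ⟨sum_thermalizePop _ _ _ _ _, [.plt P lam], by simp [Instr.Valid, Instr.IsLevelInstr], rfl, fun c hc =>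
    ⟨∑ i, |E i|, _, hc.plt β P h0 h1, fun t ht => ?_⟩⟩
  have hE : ∀ i, |E i| ≤ ∑ i, |E i| := fun i =>
    Finset.single_le_sum (f := fun i => |E i|) (fun i _ => abs_nonneg _) (Finset.mem_univ i)
  have := hc.classical t ht
  refine ⟨?_, ⟨h0, h1, this.diag⟩, ?_, rfl⟩
  · rwa [this.energy_eq]
  · rwa [(this.plt β P h0 h1).energy_eq]

end

end

/-! ### Thermalizing a pair of levels; estimates for one isothermal step. -/

section

variable {ι : Type} [DecidableEq ι]

theorem thermalizePop_congr (β : ℝ) (E : ι → ℝ) (P : Finset ι) {p q : ι → ℝ}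
    (hs : ∑ i ∈ P, p i = ∑ i ∈ P, q i) (h : ∀ i ∉ P, p i = q i) :
    thermalizePop β E P 1 p = thermalizePop β E P 1 q := by
  ext i
  unfold thermalizePop
  split_ifs with hi
  · simp [hs]
  · exact h i hi

/-- Within `P`, a full thermalization sees only the total population of `P`, so earlier
thermalizations of the same levels, at whatever energies, are forgotten. -/
theorem thermalizePop_thermalizePop (β : ℝ) (E E' : ι → ℝ) (P : Finset ι) (lam : ℝ) (p : ι → ℝ) :
    thermalizePop β E' P 1 (thermalizePop β E P lam p) = thermalizePop β E' P 1 p :=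
  thermalizePop_congr β E' P (thermalizePop_sum β E P lam p) fun i hi => by
    rw [thermalizePop, if_neg hi]

theorem thermalizePop_pair_left (β : ℝ) (E : ι → ℝ) {j k : ι} (hjk : j ≠ k) (p : ι → ℝ) :
    thermalizePop β E {j, k} 1 p j =
      Real.exp (-β * E j) / (Real.exp (-β * E j) + Real.exp (-β * E k)) * (p j + p k) := by
  simp [thermalizePop, Finset.sum_pair hjk]

theorem thermalizePop_pair_right (β : ℝ) (E : ι → ℝ) {j k : ι} (hjk : j ≠ k) (p : ι → ℝ) :
    thermalizePop β E {j, k} 1 p k =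
      Real.exp (-β * E k) / (Real.exp (-β * E j) + Real.exp (-β * E k)) * (p j + p k) := by
  simp [thermalizePop, Finset.sum_pair hjk]

theorem thermalizePop_pair_of_ne (β : ℝ) (E : ι → ℝ) {j k x : ι} (hj : x ≠ j) (hk : x ≠ k)
    (lam : ℝ) (p : ι → ℝ) : thermalizePop β E {j, k} lam p x = p x := by
  simp [thermalizePop, hj, hk]

theorem pitr_arg_pos {α : Type} {β κ : ℝ} {j k : α} {E : α → ℝ} (hβ : 0 ≤ β) (hκ : 0 ≤ κ) : 0 < Real.exp (-β * E k) +
    Real.exp (-β * E j) * (1 - Real.exp (-β * κ)) := by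
  have h1 : Real.exp (-β * κ) ≤ 1 := Real.exp_le_one_iff.2 (by nlinarith)
  have h2 := sub_nonneg.2 h1
  positivity

section pitrEnergy

variable {β : ℝ} {j k : ι} {κ : ℝ} {E : ι → ℝ}

theorem exp_pitrEnergy_left : Real.exp (-β * pitrEnergy β j k κ E j) =
    Real.exp (-β * E j) * Real.exp (-β * κ) := by
  rw [pitrEnergy, if_pos rfl, ← Real.exp_add]
  ring_nf

theorem exp_pitrEnergy_right (hβ : 0 < β) (hjk : j ≠ k) (hκ : 0 ≤ κ) :
    Real.exp (-β * pitrEnergy β j k κ E k) =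
      Real.exp (-β * E k) + Real.exp (-β * E j) * (1 - Real.exp (-β * κ)) := by
  rw [pitrEnergy, if_neg hjk.symm, if_pos rfl]
  rw [show ∀ y : ℝ, -β * (-(1 / β) * y) = y by intro y; field_simp]
  exact Real.exp_log (pitr_arg_pos hβ.le hκ)

theorem pitrEnergy_of_ne {x : ι} (hj : x ≠ j) (hk : x ≠ k) : pitrEnergy β j k κ E x = E x := by
  rw [pitrEnergy, if_neg hj, if_neg hk]

theorem pitrEnergy_zero (hβ : β ≠ 0) : pitrEnergy β j k 0 E = E := by
  ext x
  unfold pitrEnergy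
  split_ifs with h1 h2
  · simp [h1]
  · simp [h2]
    field_simp
  · rfl

/-- The energies depend continuously on a parameter in a compact interval, the argument of the
logarithm staying positive. The bound therefore serves every number of steps. -/
theorem exists_pitrEnergy_bound [Fintype ι] (hβ : 0 < β) (j k : ι) (κ : ℝ) (E : ι → ℝ) :
    ∃ M, ∀ x ∈ Set.Icc 0 κ, ∀ i, |pitrEnergy β j k x E i| ≤ M := by
  have H : ∀ i, ∃ M, ∀ x ∈ Set.Icc 0 κ, ‖pitrEnergy β j k x E i‖ ≤ M := by
    intro i
    refine isCompact_Icc.exists_bound_of_continuousOn ?_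
    unfold pitrEnergy
    split_ifs
    · fun_prop
    · refine ContinuousOn.mul continuousOn_const (ContinuousOn.log (by fun_prop) ?_)
      intro x hx
      exact (pitr_arg_pos hβ.le hx.1).ne'
    · fun_prop
  choose M hM using H
  refine ⟨∑ i, |M i|, fun x hx i => (hM i x hx).trans ((le_abs_self _).trans ?_)⟩
  exact Finset.single_le_sum (f := fun i => |M i|) (fun i _ => abs_nonneg _) (Finset.mem_univ i)

end pitrEnergy

/-- A reversible isothermal step of length `d` costs work of order `d ^ 2` on average, and has
a second moment of order `d ^ 2`. -/
theorem isothermal_step_bounds {β a b : ℝ} (hβ : 0 < β) (ha : 0 < a) (hb : 0 < b) :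
    ∃ C, 0 ≤ C ∧ ∀ x d : ℝ, 0 ≤ x → 0 ≤ d →
      let A := a * Real.exp (-β * x)
      let B := b + a * (1 - Real.exp (-β * x))
      let B' := b + a * (1 - Real.exp (-β * (x + d)))
      let h := -(1 / β) * Real.log B' - -(1 / β) * Real.log B
      |A * d + B * h| ≤ C * d ^ 2 ∧ |A * d ^ 2 + B * h ^ 2| ≤ C * d ^ 2 := by
  -- The first two terms bound the mean, the last two the second moment. The mean cancels to first
  -- order: `-βBh = B log (B'/B)` is close to `B' - B = A(1 - e^{-βd})`, which is close to `βAd`.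
  refine ⟨a * β + a ^ 2 * β / b + a + a ^ 2 / b, by positivity, fun x d hx hd => ?_⟩
  intro A B B' h
  have hex : Real.exp (-β * x) ≤ 1 := Real.exp_le_one_iff.2 (by nlinarith)
  have hA : 0 < A := by positivity
  have hAa : A ≤ a := by
    have := mul_le_mul_of_nonneg_left hex ha.le
    simpa [A] using this
  have hB : b ≤ B := by
    have := mul_nonneg ha.le (sub_nonneg.2 hex)
    simp only [B]; linarith
  set y := 1 - Real.exp (-β * d) with hy
  have hdiff : B' - B = A * y := by
    have : Real.exp (-β * (x + d)) = Real.exp (-β * x) * Real.exp (-β * d) := by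
      rw [← Real.exp_add]; ring_nf
    simp only [B, B', A, y, this]; ring
  have hy1 : y ≤ β * d := by
    have := Real.add_one_le_exp (-β * d)
    simp only [y]; linarith
  have hy0 : 0 ≤ y := by
    have : Real.exp (-β * d) ≤ 1 := Real.exp_le_one_iff.2 (by nlinarith)
    simp only [y]; linarith
  have hbd : 0 ≤ β * d := by positivity
  -- From `e^{-s}(1 + s) ≤ 1` with `s = βd`, that is `(1 - y)(1 + s) ≤ 1`, together with `y ≤ s`.
  have hy2 : β * d - (β * d) ^ 2 ≤ y := by
    have h1 := Real.add_one_le_exp (β * d)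
    have h2 : Real.exp (-β * d) * Real.exp (β * d) = 1 := by
      rw [← Real.exp_add]; simp
    have h3 := Real.exp_pos (-β * d)
    have h4 : Real.exp (-β * d) * (β * d + 1) ≤ 1 := by
      calc _ ≤ Real.exp (-β * d) * Real.exp (β * d) := mul_le_mul_of_nonneg_left h1 h3.le
        _ = 1 := h2
    have h5 : Real.exp (-β * d) = 1 - y := by simp [y]
    rw [h5] at h4
    nlinarith
  have hBp : 0 < B := hb.trans_le hB
  have hBB : B ≤ B' := by nlinarith
  have hB'p : 0 < B' := hBp.trans_le hBB
  have hlog : h = -(1 / β) * Real.log (B' / B) := by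
    rw [Real.log_div hB'p.ne' hBp.ne']; simp only [h]; ring
  set L := Real.log (B' / B) with hL
  have hL0 : 0 ≤ L := Real.log_nonneg ((one_le_div hBp).2 hBB)
  have hLu : B * L ≤ A * y := by
    have := Real.log_le_sub_one_of_pos (div_pos hB'p hBp)
    have h2 : B * (B' / B - 1) = A * y := by rw [← hdiff]; field_simp
    rw [← h2]
    exact mul_le_mul_of_nonneg_left this hBp.le
  have hLl : A * y - (A * y) ^ 2 / b ≤ B * L := by
    have h1 := Real.one_sub_inv_le_log_of_pos (div_pos hB'p hBp)
    have h2 : B * (1 - (B' / B)⁻¹) = A * y - (A * y) ^ 2 / B' := by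
      rw [← hdiff]; field_simp; ring
    have h3 := mul_le_mul_of_nonneg_left h1 hBp.le
    rw [h2] at h3
    refine le_trans ?_ h3
    have : (A * y) ^ 2 / B' ≤ (A * y) ^ 2 / b := by
      gcongr
      exact hB.trans hBB
    linarith
  have hAy : A * y ≤ A * (β * d) := by gcongr
  have hAy0 : 0 ≤ A * y := by positivity
  have hsq : (A * y) ^ 2 / b ≤ (a * (β * d)) ^ 2 / b := by gcongr
  have hBL : β * (B * h) = -(B * L) := by rw [hlog]; field_simp
  have hcd : 0 ≤ a * d ^ 2 := by positivity
  have hcd' : 0 ≤ a ^ 2 / b * d ^ 2 := by positivity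
  constructor
  · have h0 : 0 ≤ A * d + B * h := by
      have : 0 ≤ β * (A * d + B * h) := by rw [mul_add, hBL]; nlinarith
      exact nonneg_of_mul_nonneg_right this hβ
    rw [abs_of_nonneg h0]
    have h1 : β * (A * d + B * h) ≤ β * ((a * β + a ^ 2 * β / b) * d ^ 2) := by
      rw [mul_add, hBL]
      have h2 : A * (β * d - y) ≤ a * (β * d) ^ 2 := by
        have : β * d - y ≤ (β * d) ^ 2 := by linarith
        exact mul_le_mul hAa this (by linarith) ha.le
      have h3 : (a * (β * d)) ^ 2 / b = β * (a ^ 2 * β / b * d ^ 2) := by field_simp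
      have h4 : a * (β * d) ^ 2 = β * (a * β * d ^ 2) := by ring
      have h5 : β * (A * d) - A * y = A * (β * d - y) := by ring
      have h6 : β * ((a * β + a ^ 2 * β / b) * d ^ 2) =
        β * (a * β * d ^ 2) + β * (a ^ 2 * β / b * d ^ 2) := by ring
      linarith
    have h5 := le_of_mul_le_mul_left h1 hβ
    have h6 : (a * β + a ^ 2 * β / b + a + a ^ 2 / b) * d ^ 2 =
      (a * β + a ^ 2 * β / b) * d ^ 2 + a * d ^ 2 + a ^ 2 / b * d ^ 2 := by ring
    linarith
  · have h0 : 0 ≤ A * d ^ 2 + B * h ^ 2 := by positivity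
    rw [abs_of_nonneg h0]
    have h1 : B * h ^ 2 ≤ a ^ 2 / b * d ^ 2 := by
      have h2 : B * h ^ 2 = (B * L) ^ 2 / (β ^ 2 * B) := by
        rw [hlog]; field_simp
      have h3 : B * L ≤ a * (β * d) := hLu.trans (hAy.trans (by gcongr))
      have h4 : (B * L) ^ 2 / (β ^ 2 * B) ≤ (a * (β * d)) ^ 2 / (β ^ 2 * b) := by gcongr
      rw [h2]
      refine h4.trans (le_of_eq ?_)
      field_simp
    have h2 : A * d ^ 2 ≤ a * d ^ 2 := by gcongr
    have h6 : 0 ≤ a * β * d ^ 2 := by positivity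
    have h7 : 0 ≤ a ^ 2 * β / b * d ^ 2 := by positivity
    have h8 : (a * β + a ^ 2 * β / b + a + a ^ 2 / b) * d ^ 2 =
      a * β * d ^ 2 + a ^ 2 * β / b * d ^ 2 + a * d ^ 2 + a ^ 2 / b * d ^ 2 := by ring
    linarith

/-- First and second moments that grow by small amounts. -/
theorem moment_growth {a b e v : ℕ → ℝ} {q K : ℝ} {t : ℕ}
    (ha : ∀ r < t, a (r + 1) = a r + e r * q)
    (hb : ∀ r < t, b (r + 1) = b r + 2 * e r * a r + v r * q)
    (he : ∀ r < t, |e r| ≤ K) (hv : ∀ r < t, |v r| ≤ K) (hK : 0 ≤ K) :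
    |a t| ≤ |a 0| + t * K * |q| ∧
      |b t| ≤ |b 0| + t * K * (2 * (|a 0| + t * K * |q|) + |q|) := by
  have H : ∀ r ≤ t, |a r| ≤ |a 0| + r * K * |q| := by
    intro r
    induction r with
    | zero => simp
    | succ r ih =>
      intro hr
      rw [ha r hr]
      have h1 := ih (by omega)
      have h2 : |e r * q| ≤ K * |q| := by rw [abs_mul]; gcongr; exact he r hr
      have := abs_add_le (a r) (e r * q)
      push_cast
      linarith
  refine ⟨H t le_rfl, ?_⟩
  have H' : ∀ r ≤ t, |b r| ≤ |b 0| + r * K * (2 * (|a 0| + t * K * |q|) + |q|) := by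
    intro r
    induction r with
    | zero => simp
    | succ r ih =>
      intro hr
      rw [hb r hr]
      have h1 := ih (by omega)
      have h2 : |v r * q| ≤ K * |q| := by rw [abs_mul]; gcongr; exact hv r hr
      have h4 : |a r| ≤ |a 0| + t * K * |q| := by
        refine (H r (by omega)).trans ?_
        have : (r : ℝ) ≤ t := by exact_mod_cast (by omega : r ≤ t)
        gcongr
      have h3 : |2 * e r * a r| ≤ 2 * K * (|a 0| + t * K * |q|) := by
        rw [abs_mul, abs_mul, abs_two]
        have := he r hr
        gcongr
      have := abs_add_three (b r) (2 * e r * a r) (v r * q)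
      push_cast
      linarith
  exact H' t le_rfl

/-! ### The rounds of an isothermal process. -/

section isothermal

variable [Fintype ι] (β : ℝ) (j k : ι) (κ : ℝ) (t : ℕ) (E : ι → ℝ)

/-- The work spent in the levels at the Level Transformation of round `r` of a Partial Isothermal
Reversible Process. -/
def roundWork (r : ℕ) : ι → ℝ := fun i =>
  pitrEnergy β j k ((r + 1 : ℕ) * κ / t) E i - pitrEnergy β j k ((r : ℕ) * κ / t) E i

/-- The configuration after `r` of the `t` rounds of a Partial Isothermal Reversible Process. -/
def rounds (c : Config ι) : ℕ → Config ι
  | 0 => (CoarseOp.plt {j, k} 1).apply β c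
  | r + 1 => (CoarseOp.plt {j, k} 1).apply β ((CoarseOp.lt (roundWork β j k κ t E r)).apply β
      (rounds c r))

variable {β j k κ t E} {p : ι → ℝ} {c : Config ι}

theorem IsClassical.rounds_lt {q : ι → ℝ} {c : Config ι} {r : ℕ}
    (hc : IsClassical (pitrEnergy β j k (r * κ / t) E) q c) :
    IsClassical (pitrEnergy β j k ((r + 1 : ℕ) * κ / t) E) q
      ((CoarseOp.lt (roundWork β j k κ t E r)).apply β c) := by
  have := hc.lt β (roundWork β j k κ t E r)
  simpa [roundWork] using this

theorem IsClassical.rounds (hβ : β ≠ 0) (hc : IsClassical E p c) (r : ℕ) :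
    IsClassical (pitrEnergy β j k (r * κ / t) E)
      (thermalizePop β (pitrEnergy β j k (r * κ / t) E) {j, k} 1 p) (rounds β j k κ t E c r) := by
  induction r with
  | zero =>
    simp only [Nat.cast_zero, zero_mul, zero_div, pitrEnergy_zero hβ, Thermo.rounds]
    exact hc.plt β {j, k} zero_le_one le_rfl
  | succ r ih =>
    have := ih.rounds_lt.plt β {j, k} zero_le_one le_rfl
    rwa [thermalizePop_thermalizePop] at this

theorem runs_rounds (hβ : β ≠ 0) (hc : IsClassical E p c) {M : ℝ} (ht : 1 ≤ t)
    (hM : ∀ x ∈ Set.Icc 0 κ, ∀ i, |pitrEnergy β j k x E i| ≤ M) (hκ : 0 ≤ κ) {r : ℕ} (hr : r ≤ t) :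
    CoarseOp.Runs β M (CoarseOp.plt {j, k} 1 :: (List.range r).flatMap fun r =>
      [CoarseOp.lt (roundWork β j k κ t E r), CoarseOp.plt {j, k} 1]) c
        (rounds β j k κ t E c r) := by
  have hM' : ∀ s ≤ t, ∀ i, |pitrEnergy β j k (s * κ / t) E i| ≤ M := by
    intro s hs
    have h1 : (s : ℝ) ≤ t := by exact_mod_cast hs
    have h2 : (0 : ℝ) < t := by exact_mod_cast ht
    refine hM _ ⟨by positivity, ?_⟩
    rw [div_le_iff₀ h2, mul_comm]
    gcongr
  induction r with
  | zero =>
    have h0 := hM' 0 (Nat.zero_le _)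
    simp only [Nat.cast_zero, zero_mul, zero_div, pitrEnergy_zero hβ] at h0
    have h1 : ∀ i, |c.energy i| ≤ M := by rwa [hc.energy_eq]
    exact ⟨h1, ⟨zero_le_one, le_rfl, hc.diag⟩, h1, rfl⟩
  | succ r ih =>
    rw [List.range_succ, List.flatMap_append, ← List.cons_append]
    refine (ih (by omega)).append ?_
    have h1 := hc.rounds (j := j) (k := k) (κ := κ) (t := t) hβ r
    have h2 := h1.rounds_lt
    have h3 := hc.rounds (j := j) (k := k) (κ := κ) (t := t) hβ (r + 1)
    refine ⟨?_, h1.diag, ?_, ⟨zero_le_one, le_rfl, h2.diag⟩, ?_, rfl⟩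
    · rw [h1.energy_eq]; exact hM' r (by omega)
    · rw [h2.energy_eq]; exact hM' (r + 1) hr
    · change ∀ i, |(Thermo.rounds β j k κ t E c (r + 1)).energy i| ≤ M
      rw [h3.energy_eq]; exact hM' (r + 1) hr

/-- Every round ends in a full thermalization, so each moment of the work is shared between `j` and
`k` in the ratio of their Boltzmann weights. Only the sums over the pair need to be followed. -/
theorem avg_rounds_thermal (hβ : β ≠ 0) (hc : IsClassical E p c) (r : ℕ) (f : ℝ → ℝ) :
    (rounds β j k κ t E c r).avg f =
      thermalizePop β (pitrEnergy β j k (r * κ / t) E) {j, k} 1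
        ((rounds β j k κ t E c r).avg f) := by
  cases r with
  | zero =>
    simp only [Nat.cast_zero, zero_mul, zero_div, pitrEnergy_zero hβ, Thermo.rounds]
    rw [avg_plt, hc.energy_eq, thermalizePop_thermalizePop]
  | succ r =>
    have h2 := (hc.rounds (j := j) (k := k) (κ := κ) (t := t) hβ r).rounds_lt
    rw [Thermo.rounds, avg_plt, h2.energy_eq, thermalizePop_thermalizePop]

theorem avg_rounds_succ (r : ℕ) (f : ℝ → ℝ) (hjk : j ≠ k) :
    (rounds β j k κ t E c (r + 1)).avg f j + (rounds β j k κ t E c (r + 1)).avg f k =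
      (rounds β j k κ t E c r).avg (fun w => f (w + roundWork β j k κ t E r j)) j +
      (rounds β j k κ t E c r).avg (fun w => f (w + roundWork β j k κ t E r k)) k := by
  rw [Thermo.rounds, avg_plt, ← Finset.sum_pair hjk, thermalizePop_sum, Finset.sum_pair hjk,
    avg_lt, avg_lt]

theorem avg_rounds_of_ne (r : ℕ) (f : ℝ → ℝ) {x : ι} (hj : x ≠ j) (hk : x ≠ k) :
    (rounds β j k κ t E c r).avg f x = c.avg f x := by
  induction r with
  | zero => rw [Thermo.rounds, avg_plt, thermalizePop_pair_of_ne _ _ hj hk]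
  | succ r ih =>
    rw [Thermo.rounds, avg_plt, thermalizePop_pair_of_ne _ _ hj hk, avg_lt]
    simpa [roundWork, pitrEnergy_of_ne hj hk] using ih

end isothermal

end

/-! ### The work of an isothermal process vanishes in the limit. -/

section

variable {ι : Type} [DecidableEq ι] [Fintype ι]

/-- With steps of length `κ / t`, a round changes the mean work of the pair by `O(1/t²)`, and its
second moment by `O(1/t²)` plus a cross term that is `O(1/t²)` times the current mean. Over `t`
rounds this is `O(1/t)`. The constant depends neither on `t` nor on the work already recorded. -/
theorem exists_round_moment_bounds {β : ℝ} (hβ : 0 < β) {j k : ι} (hjk : j ≠ k) {κ : ℝ}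
    (hκ : 0 < κ) (E p : ι → ℝ) : ∃ C, 0 ≤ C ∧ ∀ (t : ℕ) (c : Config ι), 1 ≤ t → IsClassical E p c →
      |(rounds β j k κ t E c t).avg (fun w => w) j + (rounds β j k κ t E c t).avg (fun w => w) k| ≤
        |c.avg (fun w => w) j + c.avg (fun w => w) k| + C / t ∧
      |(rounds β j k κ t E c t).avg (fun w => w ^ 2) j +
          (rounds β j k κ t E c t).avg (fun w => w ^ 2) k| ≤
        |c.avg (fun w => w ^ 2) j + c.avg (fun w => w ^ 2) k| +
          C / t * (2 * (|c.avg (fun w => w) j + c.avg (fun w => w) k| + C / t) + 1) := by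
  set uj := Real.exp (-β * E j) with huj
  set uk := Real.exp (-β * E k) with huk
  have hujp : 0 < uj := Real.exp_pos _
  have hukp : 0 < uk := Real.exp_pos _
  obtain ⟨C₀, hC₀, H⟩ := isothermal_step_bounds hβ hujp hukp
  set q := p j + p k with hq
  -- The factor `|q| + 1` dominates both the population `q` multiplying the increments and the
  -- factor `1` of the cross term.
  refine ⟨C₀ * κ ^ 2 / (uj + uk) * (|q| + 1), by positivity, fun t c ht hc => ?_⟩
  have htp : (0 : ℝ) < t := by exact_mod_cast ht
  set K := C₀ * (κ / t) ^ 2 / (uj + uk) with hKdef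
  have hK : 0 ≤ K := by positivity
  set R := rounds β j k κ t E c
  have hexpj : ∀ r : ℕ, Real.exp (-β * pitrEnergy β j k (r * κ / t) E j) =
      uj * Real.exp (-β * (r * κ / t)) := fun r => exp_pitrEnergy_left
  have hexpk : ∀ r : ℕ, Real.exp (-β * pitrEnergy β j k (r * κ / t) E k) =
      uk + uj * (1 - Real.exp (-β * (r * κ / t))) := fun r =>
    exp_pitrEnergy_right hβ hjk (by positivity)
  set A : ℕ → ℝ := fun r => uj * Real.exp (-β * (r * κ / t))
  set B : ℕ → ℝ := fun r => uk + uj * (1 - Real.exp (-β * (r * κ / t)))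
  -- The joint weight of the pair is conserved, so one normalization serves all rounds.
  have hAB : ∀ r, A r + B r = uj + uk := fun r => by simp only [A, B]; ring
  have hj : ∀ r f, (R r).avg f j = A r / (uj + uk) * ((R r).avg f j + (R r).avg f k) := by
    intro r f
    conv_lhs => rw [avg_rounds_thermal hβ.ne' hc, thermalizePop_pair_left β _ hjk, hexpj, hexpk]
    rw [← hAB r]
  have hk : ∀ r f, (R r).avg f k = B r / (uj + uk) * ((R r).avg f j + (R r).avg f k) := by
    intro r f
    conv_lhs => rw [avg_rounds_thermal hβ.ne' hc, thermalizePop_pair_right β _ hjk, hexpj, hexpk]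
    rw [← hAB r]
  have hone : ∀ r, (R r).avg (fun _ => 1) j + (R r).avg (fun _ => 1) k = q := by
    intro r
    have h := hc.rounds (j := j) (k := k) (κ := κ) (t := t) hβ.ne' r
    rw [h.avg_one, h.avg_one, ← Finset.sum_pair hjk, thermalizePop_sum, Finset.sum_pair hjk]
  have hzero : ∀ f, (R 0).avg f j + (R 0).avg f k = c.avg f j + c.avg f k := by
    intro f
    simp only [R, rounds]
    rw [avg_plt, ← Finset.sum_pair hjk, thermalizePop_sum, Finset.sum_pair hjk]
  set hW := roundWork β j k κ t E
  have hlin : ∀ r (h : ℝ) x, (R r).avg (fun w => w + h) x =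
      (R r).avg (fun w => w) x + h * (R r).avg (fun _ => 1) x := by
    intro r h x
    rw [← Config.avg_const_mul, ← Config.avg_add]
    simp
  have hquad : ∀ r (h : ℝ) x, (R r).avg (fun w => (w + h) ^ 2) x = (R r).avg (fun w => w ^ 2) x +
      2 * h * (R r).avg (fun w => w) x + h ^ 2 * (R r).avg (fun _ => 1) x := by
    intro r h x
    rw [← Config.avg_const_mul, ← Config.avg_const_mul, ← Config.avg_add, ← Config.avg_add]
    congr 1
    ext w
    ring
  have hstep : ∀ r < t, |A r / (uj + uk) * hW r j + B r / (uj + uk) * hW r k| ≤ K ∧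
      |A r / (uj + uk) * hW r j ^ 2 + B r / (uj + uk) * hW r k ^ 2| ≤ K := by
    intro r _
    have h := H (r * κ / t) (κ / t) (by positivity) (by positivity)
    have h1 : (r : ℝ) * κ / t + κ / t = (r + 1 : ℕ) * κ / t := by push_cast; ring
    have h2 : hW r j = κ / t := by
      simp only [hW, roundWork, pitrEnergy, if_true]
      push_cast
      ring
    have h3 : hW r k = -(1 / β) * Real.log (B (r + 1)) - -(1 / β) * Real.log (B r) := by
      simp only [hW, roundWork, pitrEnergy, if_neg hjk.symm, if_true, B]
      rfl
    simp only [h1] at h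
    have h4 : ∀ y z, A r / (uj + uk) * y + B r / (uj + uk) * z = (A r * y + B r * z) / (uj + uk) := by
      intro y z; ring
    have hS : 0 < uj + uk := by positivity
    rw [h4, h4, abs_div, abs_div, abs_of_pos hS, hKdef, h2, h3]
    exact ⟨div_le_div_of_nonneg_right h.1 hS.le, div_le_div_of_nonneg_right h.2 hS.le⟩
  have hgrow := moment_growth (t := t) (q := q) (K := K)
    (a := fun r => (R r).avg (fun w => w) j + (R r).avg (fun w => w) k)
    (b := fun r => (R r).avg (fun w => w ^ 2) j + (R r).avg (fun w => w ^ 2) k)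
    (e := fun r => A r / (uj + uk) * hW r j + B r / (uj + uk) * hW r k)
    (v := fun r => A r / (uj + uk) * hW r j ^ 2 + B r / (uj + uk) * hW r k ^ 2)
    (fun r _ => by
      rw [avg_rounds_succ _ _ hjk, hlin, hlin]
      have e1 := hj r (fun _ => 1)
      have e2 := hk r (fun _ => 1)
      rw [hone] at e1 e2
      rw [e1, e2]; ring)
    (fun r _ => by
      rw [avg_rounds_succ _ _ hjk, hquad, hquad]
      have e1 := hj r (fun _ => 1)
      have e2 := hk r (fun _ => 1)
      rw [hone] at e1 e2
      have e3 := hj r (fun w => w)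
      have e4 := hk r (fun w => w)
      rw [e1, e2]
      linear_combination 2 * hW r j * e3 + 2 * hW r k * e4)
    (fun r hr => (hstep r hr).1) (fun r hr => (hstep r hr).2) hK
  simp only [hzero] at hgrow
  have hKt : t * K = C₀ * κ ^ 2 / (uj + uk) / t := by rw [hKdef]; field_simp
  have hq0 := abs_nonneg q
  have hC1 : 0 ≤ C₀ * κ ^ 2 / (uj + uk) / t := by positivity
  have hCt : C₀ * κ ^ 2 / (uj + uk) * (|q| + 1) / t = C₀ * κ ^ 2 / (uj + uk) / t * (|q| + 1) := by
    ring
  rw [hKt] at hgrow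
  rw [hCt]
  set C1 := C₀ * κ ^ 2 / (uj + uk) / t
  set a0 := |c.avg (fun w => w) j + c.avg (fun w => w) k|
  have ha0 : 0 ≤ a0 := abs_nonneg _
  refine ⟨hgrow.1.trans (by nlinarith), hgrow.2.trans ?_⟩
  have h1 : C1 * (2 * (a0 + C1 * |q|) + |q|) ≤
      C1 * (|q| + 1) * (2 * (a0 + C1 * (|q| + 1)) + 1) := by
    have : 2 * (a0 + C1 * |q|) + |q| ≤ (|q| + 1) * (2 * (a0 + C1 * (|q| + 1)) + 1) := by
      have := mul_nonneg hq0 ha0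
      have := mul_nonneg hq0 hC1
      have := mul_nonneg hq0 this
      nlinarith
    calc _ ≤ C1 * ((|q| + 1) * (2 * (a0 + C1 * (|q| + 1)) + 1)) := by gcongr
      _ = _ := by ring
  linarith

/-- The pair sums of both moments tend to zero, and the final thermalization gives `j` and `k`
fractions of them that do not depend on `t`; the other levels keep their moments. -/
theorem WorkFree.pitr {β : ℝ} (hβ : 0 < β) {j k : ι} (hjk : j ≠ k) {κ : ℝ}
    (hκ : 0 < κ) {E p : ι → ℝ} {c : ℕ → Config ι} (hc : WorkFree E p c) :
    WorkFree (pitrEnergy β j k κ E) (thermalizePop β (pitrEnergy β j k κ E) {j, k} 1 p)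
      (fun t => rounds β j k κ t E (c t) t) := by
  have hfin : ∀ t : ℕ, 1 ≤ t → (t : ℝ) * κ / t = κ := by
    intro t ht
    have : (0 : ℝ) < t := by exact_mod_cast ht
    field_simp
  obtain ⟨C, hC, H⟩ := exists_round_moment_bounds hβ hjk hκ E p
  have hCt : Tendsto (fun t : ℕ => C / (t : ℝ)) atTop (𝓝 0) := tendsto_const_div_atTop_nhds_zero_nat C
  have hm := ((hc.mean j).add (hc.mean k)).abs
  have hs := ((hc.sq j).add (hc.sq k)).abs
  simp only [add_zero, abs_zero] at hm hs
  have hm' : Tendsto (fun t => (rounds β j k κ t E (c t) t).avg (fun w => w) j +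
      (rounds β j k κ t E (c t) t).avg (fun w => w) k) atTop (𝓝 0) := by
    have hlim := hm.add hCt
    rw [add_zero] at hlim
    refine squeeze_zero_norm' ?_ hlim
    filter_upwards [eventually_ge_atTop 1] with t ht
    exact (H t (c t) ht (hc.classical t ht)).1
  have hs' : Tendsto (fun t => (rounds β j k κ t E (c t) t).avg (fun w => w ^ 2) j +
      (rounds β j k κ t E (c t) t).avg (fun w => w ^ 2) k) atTop (𝓝 0) := by
    have hlim := hs.add (hCt.mul (((hm.add hCt).const_mul 2).add_const 1))
    simp only [zero_mul, add_zero] at hlim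
    refine squeeze_zero_norm' ?_ hlim
    filter_upwards [eventually_ge_atTop 1] with t ht
    exact (H t (c t) ht (hc.classical t ht)).2
  have key : ∀ f : ℝ → ℝ, (∀ x, Tendsto (fun t => (c t).avg f x) atTop (𝓝 0)) →
      Tendsto (fun t => (rounds β j k κ t E (c t) t).avg f j +
        (rounds β j k κ t E (c t) t).avg f k) atTop (𝓝 0) →
      ∀ x, Tendsto (fun t => (rounds β j k κ t E (c t) t).avg f x) atTop (𝓝 0) := by
    intro f hf hsum x
    by_cases hxj : x = j
    · subst hxj
      have h := hsum.const_mul (Real.exp (-β * pitrEnergy β x k κ E x) /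
        (Real.exp (-β * pitrEnergy β x k κ E x) + Real.exp (-β * pitrEnergy β x k κ E k)))
      rw [mul_zero] at h
      refine h.congr' ?_
      filter_upwards [eventually_ge_atTop 1] with t ht
      have h2 := congrFun (avg_rounds_thermal (j := x) (k := k) (κ := κ) (t := t) hβ.ne'
        (hc.classical t ht) t f) x
      rw [thermalizePop_pair_left _ _ hjk, hfin t ht] at h2
      exact h2.symm
    by_cases hxk : x = k
    · subst hxk
      have h := hsum.const_mul (Real.exp (-β * pitrEnergy β j x κ E x) /
        (Real.exp (-β * pitrEnergy β j x κ E j) + Real.exp (-β * pitrEnergy β j x κ E x)))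
      rw [mul_zero] at h
      refine h.congr' ?_
      filter_upwards [eventually_ge_atTop 1] with t ht
      have h2 := congrFun (avg_rounds_thermal (j := j) (k := x) (κ := κ) (t := t) hβ.ne'
        (hc.classical t ht) t f) x
      rw [thermalizePop_pair_right _ _ hjk, hfin t ht] at h2
      exact h2.symm
    · refine (hf x).congr fun t => ?_
      rw [avg_rounds_of_ne _ _ hxj hxk]
  refine ⟨fun t ht => ?_, key _ hc.mean hm', key _ hc.sq hs'⟩
  have := (hc.classical t ht).rounds (j := j) (k := k) (κ := κ) (t := t) hβ.ne' t
  rwa [hfin t ht] at this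

theorem Steers.pitr {β : ℝ} (hβ : 0 < β) {j k : ι} (hjk : j ≠ k) {κ : ℝ} (hκ : 0 < κ)
    (E p : ι → ℝ) : Steers β E p (pitrEnergy β j k κ E)
      (thermalizePop β (pitrEnergy β j k κ E) {j, k} 1 p) := by
  obtain ⟨M, hM⟩ := exists_pitrEnergy_bound hβ j k κ E
  refine ⟨sum_thermalizePop _ _ _ _ _, [.pitr j k κ], ?_, rfl, fun c hc => ⟨M, _, hc.pitr hβ hjk hκ, fun t ht => ?_⟩⟩
  · simp [Instr.Valid, Instr.IsLevelInstr, hjk, hκ]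
  · unfold Instr.Executes
    simp only [Instr.compile, List.append_nil, (hc.classical t ht).energy_eq]
    exact runs_rounds hβ.ne' (hc.classical t ht) ht hM hκ.le le_rfl

/-! ### Redistributing the weight of two levels -/

/-- The energy levels with Boltzmann weights `u`. -/
def levels (β : ℝ) (u : ι → ℝ) : ι → ℝ := fun x => -(1 / β) * Real.log (u x)

/-- The fraction `θ` of what the levels `j` and `k` hold is given to `j`, the rest to `k`. -/
def split (j k : ι) (θ : ℝ) (f : ι → ℝ) : ι → ℝ :=
  Function.update (Function.update f j (θ * (f j + f k))) k ((1 - θ) * (f j + f k))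

section
variable {α : Type}

theorem exp_levels {β : ℝ} (hβ : β ≠ 0) {u : α → ℝ} {x : α} (hu : 0 < u x) :
    Real.exp (-β * levels β u x) = u x := by
  unfold levels
  rw [show ∀ y : ℝ, -β * (-(1 / β) * y) = y by intro y; field_simp]
  exact Real.exp_log hu

theorem eq_levels {β : ℝ} (hβ : β ≠ 0) (E : α → ℝ) : E = levels β fun x => Real.exp (-β * E x) := by
  ext x
  rw [levels, Real.log_exp]
  field_simp

variable [DecidableEq α] {j k x : α}

theorem split_left (hjk : j ≠ k) (θ : ℝ) (f : α → ℝ) : split j k θ f j = θ * (f j + f k) := by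
  simp [split, hjk]

theorem split_right (j k : α) (θ : ℝ) (f : α → ℝ) : split j k θ f k = (1 - θ) * (f j + f k) := by
  simp [split]

theorem split_of_ne (hj : x ≠ j) (hk : x ≠ k) (θ : ℝ) (f : α → ℝ) : split j k θ f x = f x := by
  simp [split, hj, hk]

theorem split_swap (hjk : j ≠ k) (θ : ℝ) (f : α → ℝ) : split j k θ f = split k j (1 - θ) f := by
  unfold split
  rw [Function.update_comm hjk, sub_sub_cancel, add_comm (f k)]

theorem split_pos {θ : ℝ} (h0 : 0 < θ) (h1 : θ < 1) {u : α → ℝ} (hu : ∀ x, 0 < u x) (x : α) :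
    0 < split j k θ u x := by
  have h2 := sub_pos.2 h1
  have h3 := add_pos (hu j) (hu k)
  unfold split
  simp only [Function.update_apply]
  split_ifs
  · positivity
  · positivity
  · exact hu x

/-- In equilibrium a pair shares its population as it shares its weight, so one operation `split`
describes the new weights and the new populations alike. -/
theorem thermalizePop_eq_split {β : ℝ} (hβ : β ≠ 0) (hjk : j ≠ k) {θ : ℝ} {u : α → ℝ}
    (hu : ∀ x, 0 < u x) (h0 : 0 < θ) (h1 : θ < 1) (p : α → ℝ) :
    thermalizePop β (levels β (split j k θ u)) {j, k} 1 p = split j k θ p := by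
  have h2 := split_pos (j := j) (k := k) h0 h1 hu
  have h3 := add_pos (hu j) (hu k)
  have h4 : θ * (u j + u k) + (1 - θ) * (u j + u k) = u j + u k := by ring
  ext x
  by_cases hxj : x = j
  · subst hxj
    rw [thermalizePop_pair_left _ _ hjk, exp_levels hβ (h2 x), exp_levels hβ (h2 k),
      split_left hjk, split_left hjk, split_right, h4]
    field_simp
  by_cases hxk : x = k
  · subst hxk
    rw [thermalizePop_pair_right _ _ hjk, exp_levels hβ (h2 x), exp_levels hβ (h2 j),
      split_left hjk, split_right, split_right, h4]
    field_simp
  · rw [thermalizePop_pair_of_ne _ _ hxj hxk, split_of_ne hxj hxk]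

end

theorem Steers.split_of_lt {β : ℝ} (hβ : 0 < β) {j k : ι} (hjk : j ≠ k) {θ : ℝ} {u : ι → ℝ}
    (hu : ∀ x, 0 < u x) (h0 : 0 < θ) (h1 : θ < 1) (hlt : θ * (u j + u k) < u j) (p : ι → ℝ) :
    Steers β (levels β u) p (levels β (split j k θ u)) (split j k θ p) := by
  have hj := hu j
  have hk := hu k
  have hr : 0 < θ * (u j + u k) / u j := by positivity
  have hr1 : θ * (u j + u k) / u j < 1 := (div_lt_one hj).2 hlt
  -- The solution of `e^{-βκ} u j = θ (u j + u k)`. It is positive exactly because level `j` loses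
  -- weight.
  set κ := -(1 / β) * Real.log (θ * (u j + u k) / u j) with hκ
  have hκ0 : 0 < κ := by
    have := Real.log_neg hr hr1
    have : 0 < 1 / β := by positivity
    rw [hκ]; nlinarith
  have hE : pitrEnergy β j k κ (levels β u) = levels β (split j k θ u) := by
    have hexp : Real.exp (-β * κ) = θ * (u j + u k) / u j := by
      rw [hκ, show ∀ y : ℝ, -β * (-(1 / β) * y) = y by intro y; field_simp, Real.exp_log hr]
    ext x
    unfold pitrEnergy
    split_ifs with hxj hxk
    · subst hxj
      rw [hκ, levels, levels, split_left hjk, Real.log_div (by positivity) hj.ne']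
      ring
    · subst hxk
      rw [exp_levels hβ.ne' hj, exp_levels hβ.ne' hk, hexp, levels, split_right]
      congr 2
      field_simp
      ring
    · rw [levels, levels, split_of_ne hxj hxk]
  have h := Steers.pitr hβ hjk hκ0 (levels β u) p
  rwa [hE, thermalizePop_eq_split hβ.ne' hjk hu h0 h1] at h

theorem Steers.split {β : ℝ} (hβ : 0 < β) {j k : ι} (hjk : j ≠ k) {θ : ℝ} {u : ι → ℝ}
    (hu : ∀ x, 0 < u x) (h0 : 0 < θ) (h1 : θ < 1) (p : ι → ℝ) :
    Steers β (levels β u) p (levels β (Thermo.split j k θ u)) (Thermo.split j k θ p) := by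
  -- Level `j` can only lose weight in the process. If its weight is unchanged, one full
  -- thermalization does; if it gains, `j` and `k` exchange roles.
  rcases lt_trichotomy (θ * (u j + u k)) (u j) with hlt | heq | hgt
  · exact Steers.split_of_lt hβ hjk hu h0 h1 hlt p
  · have hE : Thermo.split j k θ u = u := by
      ext x
      unfold Thermo.split
      rw [heq, Function.update_eq_self, Function.update_eq_iff.2]
      exact ⟨by linarith, fun _ _ => rfl⟩
    have h := Steers.plt β (levels β u) p {j, k} zero_le_one le_rfl
    have h2 := thermalizePop_eq_split hβ.ne' hjk hu h0 h1 p
    rw [hE] at h2 ⊢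
    rwa [h2] at h
  · rw [split_swap hjk, split_swap hjk]
    exact Steers.split_of_lt hβ hjk.symm hu (by linarith) (by linarith) (by linarith) p

end

/-! ### Flows through an almost empty carrier level. -/

section approach

variable {ι : Type} [DecidableEq ι] [Fintype ι]

/-- Populations converging to `p` as `δ → 0+`, on levels of Boltzmann weights `u δ`, can be reached
from the populations `p₀` on the levels of weights `u₀`. -/
def Approaches (β : ℝ) (u₀ p₀ : ι → ℝ) (u : ℝ → ι → ℝ) (p : ι → ℝ) : Prop :=
  (∀ᶠ δ in 𝓝[>] (0 : ℝ), ∀ x, 0 < u δ x) ∧ ∃ q : ℝ → ι → ℝ,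
    (∀ᶠ δ in 𝓝[>] (0 : ℝ), Steers β (levels β u₀) p₀ (levels β (u δ)) (q δ)) ∧
      ∀ x, Tendsto (fun δ => q δ x) (𝓝[>] 0) (𝓝 (p x))

variable {β : ℝ} {u₀ p₀ p p' : ι → ℝ} {u u' : ℝ → ι → ℝ}

theorem Approaches.congr (h : Approaches β u₀ p₀ u p) (hu : ∀ᶠ δ in 𝓝[>] (0 : ℝ), u δ = u' δ)
    (hp : p = p') : Approaches β u₀ p₀ u' p' := by
  subst hp
  obtain ⟨h1, q, h2, h3⟩ := h
  refine ⟨?_, q, ?_, h3⟩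
  · filter_upwards [h1, hu] with δ h1 hu
    rwa [← hu]
  · filter_upwards [h2, hu] with δ h2 hu
    rwa [← hu]

theorem Approaches.refl (hu : ∀ x, 0 < u₀ x) : Approaches β u₀ p₀ (fun _ => u₀) p₀ :=
  ⟨Eventually.of_forall fun _ => hu, fun _ => p₀, Eventually.of_forall fun _ => Steers.refl _ _ _,
    fun _ => tendsto_const_nhds⟩

theorem Approaches.split (hβ : 0 < β) (h : Approaches β u₀ p₀ u p) {j k : ι} (hjk : j ≠ k)
    {θ : ℝ → ℝ} {θ₀ : ℝ} (hθ : ∀ᶠ δ in 𝓝[>] (0 : ℝ), 0 < θ δ ∧ θ δ < 1)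
    (hlim : Tendsto θ (𝓝[>] 0) (𝓝 θ₀)) :
    Approaches β u₀ p₀ (fun δ => Thermo.split j k (θ δ) (u δ)) (Thermo.split j k θ₀ p) := by
  obtain ⟨h1, q, h2, h3⟩ := h
  refine ⟨?_, fun δ => Thermo.split j k (θ δ) (q δ), ?_, fun x => ?_⟩
  · filter_upwards [h1, hθ] with δ h1 hθ
    exact split_pos hθ.1 hθ.2 h1
  · filter_upwards [h1, hθ, h2] with δ h1 hθ h2
    exact h2.trans (Steers.split hβ hjk h1 hθ.1 hθ.2 _)
  · have h4 := (h3 j).add (h3 k)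
    by_cases hxj : x = j
    · subst hxj
      simp only [split_left hjk]
      exact hlim.mul h4
    by_cases hxk : x = k
    · subst hxk
      simp only [split_right]
      exact (hlim.const_sub 1).mul h4
    · simp only [split_of_ne hxj hxk]
      exact h3 x

/-- Moving the weight `τ` from level `x` to level `y` by way of an almost empty level `z`. -/
theorem Approaches.transfer (hβ : 0 < β) (h : Approaches β u₀ p₀ u p) {x y z : ι} (hxz : x ≠ z)
    (hyz : y ≠ z) (hxy : x ≠ y) {τ : ℝ → ℝ} {T wx wy : ℝ} (hT : 0 < T) (hwx : 0 < wx) (hwy : 0 ≤ wy)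
    (hτ : Tendsto τ (𝓝[>] 0) (𝓝 T)) (hux : Tendsto (fun δ => u δ x) (𝓝[>] 0) (𝓝 wx))
    (huy : Tendsto (fun δ => u δ y) (𝓝[>] 0) (𝓝 wy))
    (huz : Tendsto (fun δ => u δ z) (𝓝[>] 0) (𝓝 0)) (hpz : p z = 0)
    (hlt : ∀ᶠ δ in 𝓝[>] (0 : ℝ), τ δ < u δ x) :
    Approaches β u₀ p₀
      (fun δ => Function.update (Function.update (u δ) x (u δ x - τ δ)) y (u δ y + τ δ))
      (Function.update (Function.update p x (p x - T * (p x / wx))) y (p y + T * (p x / wx))) := by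
  have hτ0 : ∀ᶠ δ in 𝓝[>] (0 : ℝ), 0 < τ δ := hτ.eventually (lt_mem_nhds hT)
  -- Level `x` keeps the weight `u x - τ` and the carrier `z` rises to `u z + τ`. Since `z` is empty
  -- in the limit, it takes the share `T / wx` of the population of `x`.
  have s1 := h.split hβ hxz (θ := fun δ => (u δ x - τ δ) / (u δ x + u δ z))
    (θ₀ := (wx - T) / wx) (by
      filter_upwards [h.1, hτ0, hlt] with δ h1 h2 h3
      have := h1 x
      have := h1 z
      exact ⟨div_pos (by linarith) (by linarith), (div_lt_one (by linarith)).2 (by linarith)⟩)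
    (by
      have := (hux.sub hτ).div (hux.add huz) (by simpa using hwx.ne')
      rwa [add_zero] at this)
  -- The carrier falls back to `u z` and passes `τ` on to `y`. The fraction it retains tends to zero
  -- because `T > 0` keeps the limiting denominator positive, even if `y` starts without weight.
  have s2 := s1.split hβ hyz.symm (θ := fun δ => u δ z / (u δ z + τ δ + u δ y)) (θ₀ := 0) (by
      filter_upwards [h.1, hτ0] with δ h1 h2
      have := h1 y
      have := h1 z
      exact ⟨div_pos (by linarith) (by linarith), (div_lt_one (by linarith)).2 (by linarith)⟩)
    (by
      have := huz.div ((huz.add hτ).add huy) (by linarith)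
      rwa [zero_div] at this)
  refine s2.congr ?_ ?_
  · filter_upwards [h.1, hτ0] with δ h1 h2
    have hx := h1 x
    have hy := h1 y
    have hz := h1 z
    have e1 : (u δ x - τ δ) / (u δ x + u δ z) * (u δ x + u δ z) = u δ x - τ δ := by
      field_simp
    have e2 : (1 - (u δ x - τ δ) / (u δ x + u δ z)) * (u δ x + u δ z) = u δ z + τ δ := by
      rw [sub_mul, e1]; ring
    have e3 : u δ z / (u δ z + τ δ + u δ y) * (u δ z + τ δ + u δ y) = u δ z := by
      have : u δ z + τ δ + u δ y ≠ 0 := by positivity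
      field_simp
    have e4 : (1 - u δ z / (u δ z + τ δ + u δ y)) * (u δ z + τ δ + u δ y) = u δ y + τ δ := by
      rw [sub_mul, e3]; ring
    ext a
    by_cases ha : a = y
    · subst ha
      rw [split_right, split_right, split_of_ne hxy.symm hyz, e2, e4, Function.update_self]
    rw [Function.update_of_ne ha]
    by_cases hz' : a = z
    · subst hz'
      rw [split_left hyz.symm, split_right, split_of_ne hxy.symm hyz, e2, e3,
        Function.update_of_ne hxz.symm]
    rw [split_of_ne hz' ha]
    by_cases hx' : a = x
    · subst hx'
      rw [split_left hxz, e1, Function.update_self]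
    · rw [split_of_ne hx' hz', Function.update_of_ne hx']
  · ext a
    by_cases ha : a = y
    · subst ha
      rw [split_right, split_right, split_of_ne hxy.symm hyz, Function.update_self, hpz]
      field_simp
      ring
    rw [Function.update_of_ne ha]
    by_cases hz' : a = z
    · subst hz'
      rw [split_left hyz.symm, Function.update_of_ne hxz.symm, hpz]
      ring
    rw [split_of_ne hz' ha]
    by_cases hx' : a = x
    · subst hx'
      rw [split_left hxz, Function.update_self, hpz]
      field_simp
      ring
    · rw [split_of_ne hx' hz', Function.update_of_ne hx']

end approach

/-! ### Transport plans on levels that are split in two. -/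

section pairs

variable {m : Type} [DecidableEq m] [Fintype m] {β : ℝ} {u₀ p₀ p : m × Fin 2 → ℝ}
  {u : ℝ → m × Fin 2 → ℝ}

/-- The pairs are disjoint, so they can be split one after another. This prepares the almost empty
levels at the start and restores the ancilla Hamiltonian at the end. -/
theorem Approaches.split_pairs (hβ : 0 < β) (h : Approaches β u₀ p₀ u p) {θ : ℝ → m → ℝ}
    {θ₀ : m → ℝ} (hθ : ∀ᶠ δ in 𝓝[>] (0 : ℝ), ∀ i, 0 < θ δ i ∧ θ δ i < 1)
    (hlim : ∀ i, Tendsto (fun δ => θ δ i) (𝓝[>] 0) (𝓝 (θ₀ i))) :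
    Approaches β u₀ p₀
      (fun δ x => (if x.2 = 0 then θ δ x.1 else 1 - θ δ x.1) * (u δ (x.1, 0) + u δ (x.1, 1)))
      (fun x => (if x.2 = 0 then θ₀ x.1 else 1 - θ₀ x.1) * (p (x.1, 0) + p (x.1, 1))) := by
  have key : ∀ S : Finset m, Approaches β u₀ p₀
      (fun δ x => if x.1 ∈ S then
        (if x.2 = 0 then θ δ x.1 else 1 - θ δ x.1) * (u δ (x.1, 0) + u δ (x.1, 1)) else u δ x)
      (fun x => if x.1 ∈ S then
        (if x.2 = 0 then θ₀ x.1 else 1 - θ₀ x.1) * (p (x.1, 0) + p (x.1, 1)) else p x) := by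
    intro S
    induction S using Finset.induction_on with
    | empty => simpa using h
    | insert i S hi ih =>
      have hne : ((i, 0) : m × Fin 2) ≠ (i, 1) := by simp
      have hval : ∀ (t : ℝ) (s : m → ℝ) (f : m × Fin 2 → ℝ), s i = t →
          Thermo.split (i, 0) (i, 1) t (fun x => if x.1 ∈ S then
            (if x.2 = 0 then s x.1 else 1 - s x.1) * (f (x.1, 0) + f (x.1, 1)) else f x) =
          fun x => if x.1 ∈ insert i S then
            (if x.2 = 0 then s x.1 else 1 - s x.1) * (f (x.1, 0) + f (x.1, 1)) else f x := by
        rintro t s f rfl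
        ext ⟨i', b⟩
        by_cases hii : i' = i
        · subst hii
          fin_cases b
          · rw [Fin.zero_eta, split_left hne]; simp [hi]
          · rw [Fin.mk_one, split_right]; simp [hi]
        · rw [split_of_ne (by simp [hii]) (by simp [hii])]
          simp [hii]
      have := ih.split hβ hne (θ := fun δ => θ δ i) (hθ.mono fun δ hδ => hδ i) (hlim i)
      refine this.congr (Eventually.of_forall fun δ => ?_) ?_
      · exact hval _ (θ δ) (u δ) rfl
      · exact hval _ θ₀ p rfl
  simpa using key Finset.univ

/-- What flows out of level `j` by the transports in `S`. -/
def outflow (T : m → m → ℝ) (S : Finset (m × m)) (j : m) : ℝ :=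
  ∑ a ∈ S, if a.2 = j then T a.1 a.2 else 0

/-- What flows into level `i` by the transports in `S`, every unit of weight coming from level `j`
counting as `s j`. -/
def inflow (T : m → m → ℝ) (s : m → ℝ) (S : Finset (m × m)) (i : m) : ℝ :=
  ∑ a ∈ S, if a.1 = i then T a.1 a.2 * s a.2 else 0

theorem outflow_le {T : m → m → ℝ} (hT : ∀ i j, 0 ≤ T i j) (S : Finset (m × m)) (j : m) :
    outflow T S j ≤ ∑ i, T i j := by
  have : ∑ i, T i j = outflow T Finset.univ j := by
    simp only [outflow, ← Finset.univ_product_univ, Finset.sum_product, Finset.sum_ite_eq',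
      Finset.mem_univ, if_true]
  rw [this]
  refine Finset.sum_le_sum_of_subset_of_nonneg (Finset.subset_univ _) fun a _ _ => ?_
  split_ifs
  exacts [hT _ _, le_rfl]

theorem inflow_nonneg {m : Type} [DecidableEq m] {T : m → m → ℝ} (hT : ∀ i j, 0 ≤ T i j) {s : m → ℝ} (hs : ∀ j, 0 ≤ s j)
    (S : Finset (m × m)) (i : m) : 0 ≤ inflow T s S i := by
  refine Finset.sum_nonneg fun a _ => ?_
  split_ifs
  exacts [mul_nonneg (hT _ _) (hs _), le_rfl]

/-- Omitting the row of the carrier's pair leaves the share `T l j` behind in level `j`, to be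
collected later. -/
theorem outflow_filter {T : m → m → ℝ} (l j : m) :
    outflow T (Finset.univ.filter fun a => a.1 ≠ l) j = ∑ i, T i j - T l j := by
  have h1 : ∀ i, (∑ k, if i ≠ l then (if k = j then T i k else 0) else 0) =
      if i ≠ l then T i j else 0 := by
    intro i
    split_ifs
    · simp
    · simp
  simp only [outflow, Finset.sum_filter, ← Finset.univ_product_univ, Finset.sum_product, h1]
  rw [eq_sub_iff_add_eq, ← Finset.sum_filter, Finset.filter_ne', Finset.sum_erase_add]
  exact Finset.mem_univ l

theorem inflow_filter {T : m → m → ℝ} {s : m → ℝ} (l i : m) :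
    inflow T s (Finset.univ.filter fun a => a.1 ≠ l) i = if i = l then 0 else ∑ j, T i j * s j := by
  simp only [inflow, Finset.sum_filter, ← Finset.univ_product_univ, Finset.sum_product]
  rw [Finset.sum_eq_single i]
  · by_cases h : i = l <;> simp [h]
  · intro k _ hk
    simp [hk]
  · simp

variable {D η : m → ℝ} {T : m → m → ℝ}

theorem eventually_small : ∀ᶠ δ in 𝓝[>] (0 : ℝ), 0 < δ ∧ δ < 1 / 2 :=
  Ioo_mem_nhdsGT (by norm_num)

theorem tendsto_eval_zero {f : ℝ → ℝ} {a : ℝ} (hf : Continuous f) (h : f 0 = a) :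
    Tendsto f (𝓝[>] 0) (𝓝 a) := by
  rw [← h]
  exact (hf.tendsto 0).mono_left nhdsWithin_le_nhds

/-- Transports into the second levels of the pairs other than `l`, whose second level serves as
carrier. -/
theorem approaches_transport (hβ : 0 < β) (hD : ∀ i, 0 < D i) (hT : ∀ i j, 0 ≤ T i j)
    (hcol : ∀ j, ∑ i, T i j = D j) (l : m)
    (h : Approaches β u₀ p₀ (fun δ x => if x.2 = 0 then (1 - δ) * D x.1 else δ * D x.1)
      (fun x => if x.2 = 0 then η x.1 else 0)) (S : Finset (m × m)) (hS : ∀ a ∈ S, a.1 ≠ l) :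
    Approaches β u₀ p₀
      (fun δ x => if x.2 = 0 then (1 - δ) * D x.1 - (1 - 2 * δ) * outflow T S x.1
        else δ * D x.1 + (1 - 2 * δ) * inflow T 1 S x.1)
      (fun x => if x.2 = 0 then η x.1 - outflow T S x.1 * (η x.1 / D x.1)
        else inflow T (fun j => η j / D j) S x.1) := by
  induction S using Finset.induction_on with
  | empty => simpa [outflow, inflow] using h
  | insert a S ha ih =>
    obtain ⟨i, j⟩ := a
    have hil : i ≠ l := hS _ (Finset.mem_insert_self _ _)
    have hSl : ∀ a ∈ S, a.1 ≠ l := fun a h => hS a (Finset.mem_insert_of_mem h)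
    specialize ih hSl
    have hout : ∀ j', outflow T (insert (i, j) S) j' =
        outflow T S j' + if j' = j then T i j else 0 := by
      intro j'
      simp only [outflow, Finset.sum_insert ha, eq_comm (a := j')]
      ring
    have hin : ∀ (s : m → ℝ) i', inflow T s (insert (i, j) S) i' =
        inflow T s S i' + if i' = i then T i j * s j else 0 := by
      intro s i'
      simp only [inflow, Finset.sum_insert ha, eq_comm (a := i')]
      ring
    have hinl : ∀ s : m → ℝ, inflow T s S l = 0 := fun s =>
      Finset.sum_eq_zero fun a h => if_neg (hSl a h)
    -- A zero entry needs no move, and `Approaches.transfer` would not cover it, as it requires a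
    -- positive limit.
    rcases (hT i j).eq_or_lt with h0 | hpos
    · refine ih.congr (Eventually.of_forall fun δ => ?_) ?_ <;> ext x <;> simp [hout, hin, ← h0]
    have hle := outflow_le hT (insert (i, j) S) j
    rw [hout, if_pos rfl, hcol] at hle
    have hw : 0 < D j - outflow T S j := by linarith
    have hxy : ((j, 0) : m × Fin 2) ≠ (i, 1) := by simp
    -- Scaling the plan by `1 - 2δ` keeps the source above zero: even if all of `D j` flows out, the
    -- weight `(1 - δ) D j - (1 - 2δ) D j = δ D j` remains.
    have := ih.transfer hβ (x := (j, 0)) (y := (i, 1)) (z := (l, 1)) (by simp) (by simpa using hil)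
      hxy (τ := fun δ => (1 - 2 * δ) * T i j) hpos hw
      (inflow_nonneg hT (fun _ => zero_le_one) S i)
      (tendsto_eval_zero (by fun_prop) (by simp))
      (by simp only [if_true]; exact tendsto_eval_zero (by fun_prop) (by simp))
      (by simp only [one_ne_zero, if_false]; exact tendsto_eval_zero (by fun_prop) (by simp; rfl))
      (by simp only [one_ne_zero, if_false, hinl]; exact tendsto_eval_zero (by fun_prop) (by simp))
      (by simp [hinl]) (by
        filter_upwards [eventually_small] with δ hδ
        have := hD j
        simp only [if_true]
        nlinarith)
    refine this.congr (Eventually.of_forall fun δ => ?_) ?_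
    · ext ⟨i', b⟩
      fin_cases b
      · rw [Function.update_of_ne (by simp)]
        by_cases hj : i' = j
        · subst hj
          rw [Fin.zero_eta, Function.update_self]
          simp [hout]
          ring
        · rw [Function.update_of_ne (by simpa using hj)]
          simp [hout, hj]
      · by_cases hi : i' = i
        · subst hi
          rw [Fin.mk_one, Function.update_self]
          simp [hin]
          ring
        · rw [Function.update_of_ne (by simpa using hi), Function.update_of_ne (by simp)]
          simp [hin, hi]
    · have hs : (η j - outflow T S j * (η j / D j)) / (D j - outflow T S j) = η j / D j := by
        have := hD j
        field_simp
      ext ⟨i', b⟩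
      fin_cases b
      · rw [Function.update_of_ne (by simp)]
        by_cases hj : i' = j
        · subst hj
          rw [Fin.zero_eta, Function.update_self]
          simp only [if_true, hs, hout]
          ring
        · rw [Function.update_of_ne (by simpa using hj)]
          simp [hout, hj]
      · by_cases hi : i' = i
        · subst hi
          rw [Fin.mk_one, Function.update_self]
          simp [hin, hs]
        · rw [Function.update_of_ne (by simpa using hi), Function.update_of_ne (by simp)]
          simp [hin, hi]

/-- What is left in the first levels is collected in the first level of the pair `l`. -/
theorem approaches_collect (hβ : 0 < β) (hD : ∀ i, 0 < D i) (hT : ∀ i j, 0 ≤ T i j) (l : m)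
    {v : ℝ → m → ℝ} {r s : m → ℝ}
    (hv : ∀ δ, v δ l = δ * D l) (hr : r l = 0)
    (h : Approaches β u₀ p₀
      (fun δ x => if x.2 = 0 then δ * D x.1 + (1 - 2 * δ) * T l x.1 else v δ x.1)
      (fun x => if x.2 = 0 then T l x.1 * s x.1 else r x.1)) (S : Finset m) (hS : l ∉ S) :
    Approaches β u₀ p₀
      (fun δ x => if x.2 = 0 then δ * D x.1 + (1 - 2 * δ) *
        (if x.1 = l then T l l + ∑ j ∈ S, T l j else if x.1 ∈ S then 0 else T l x.1) else v δ x.1)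
      (fun x => if x.2 = 0 then
        (if x.1 = l then T l l * s l + ∑ j ∈ S, T l j * s j else
          if x.1 ∈ S then 0 else T l x.1 * s x.1) else r x.1) := by
  induction S using Finset.induction_on with
  | empty =>
    refine h.congr (Eventually.of_forall fun δ => ?_) ?_ <;> ext ⟨i, b⟩ <;>
      by_cases hi : i = l <;> simp [hi]
  | insert j S hj ih =>
    have hjl : j ≠ l := fun h => hS (h ▸ Finset.mem_insert_self _ _)
    specialize ih (fun h => hS (Finset.mem_insert_of_mem h))
    rcases (hT l j).eq_or_lt with h0 | hpos
    · refine ih.congr (Eventually.of_forall fun δ => ?_) ?_ <;> ext ⟨i, b⟩ <;>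
        by_cases hi : i = l <;> by_cases hij : i = j <;> simp [hi, hij, hj, hjl, ← h0]
    -- Here the limiting amount equals the limiting weight of the source: it is emptied in the
    -- limit, and for positive `δ` the weight `δ D j` stays.
    have := ih.transfer hβ (x := (j, 0)) (y := (l, 0)) (z := (l, 1)) (by simp) (by simp)
      (by simpa using hjl) (τ := fun δ => (1 - 2 * δ) * T l j) hpos hpos
      (add_nonneg (hT l l) (Finset.sum_nonneg fun j (_ : j ∈ S) => hT l j))
      (tendsto_eval_zero (by fun_prop) (by simp))
      (by simp only [if_true, hjl, hj, if_false]; exact tendsto_eval_zero (by fun_prop) (by simp))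
      (by simp only [if_true]; exact tendsto_eval_zero (by fun_prop) (by simp))
      (by simp only [one_ne_zero, if_false, hv]; exact tendsto_eval_zero (by fun_prop) (by simp))
      (by simp [hr]) (by
        filter_upwards [eventually_small] with δ hδ
        have := mul_pos hδ.1 (hD j)
        simp only [if_true, hjl, if_false, hj]
        linarith)
    have hp : T l j * (T l j * s j / T l j) = T l j * s j := by field_simp
    refine this.congr (Eventually.of_forall fun δ => ?_) ?_
    · ext ⟨i, b⟩
      by_cases hl : (i, b) = (l, 0)
      · rw [hl, Function.update_self]
        simp [Finset.sum_insert hj]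
        ring
      rw [Function.update_of_ne hl]
      by_cases hj' : (i, b) = (j, 0)
      · rw [hj', Function.update_self]
        simp [hjl, hj]
      rw [Function.update_of_ne hj']
      fin_cases b
      · have h1 : i ≠ l := fun h => hl (by simp [h])
        have h2 : i ≠ j := fun h => hj' (by simp [h])
        simp [h1, h2]
      · simp
    · ext ⟨i, b⟩
      by_cases hl : (i, b) = (l, 0)
      · rw [hl, Function.update_self]
        simp [Finset.sum_insert hj, hjl, hj, hp]
        ring
      rw [Function.update_of_ne hl]
      by_cases hj' : (i, b) = (j, 0)
      · rw [hj', Function.update_self]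
        simp [hjl, hj, hp]
      rw [Function.update_of_ne hj']
      fin_cases b
      · have h1 : i ≠ l := fun h => hl (by simp [h])
        have h2 : i ≠ j := fun h => hj' (by simp [h])
        simp [h1, h2]
      · simp

/-- Any transport plan between the levels can be carried out to any accuracy, when every level is
split in two. -/
theorem exists_steers_transport (hβ : 0 < β) (hu₀ : ∀ x, 0 < u₀ x)
    (hpair : ∀ i, u₀ (i, 0) + u₀ (i, 1) = D i) (hT : ∀ i j, 0 ≤ T i j)
    (hrow : ∀ i, ∑ j, T i j = D i) (hcol : ∀ j, ∑ i, T i j = D j) (l : m) :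
    ∃ q : ℝ → m × Fin 2 → ℝ,
      (∀ᶠ δ in 𝓝[>] (0 : ℝ), Steers β (levels β u₀) p₀ (levels β u₀) (q δ)) ∧
      ∀ i, Tendsto (fun δ => q δ (i, 0) + q δ (i, 1)) (𝓝[>] 0)
        (𝓝 (∑ j, T i j * ((p₀ (j, 0) + p₀ (j, 1)) / D j))) := by
  have hD : ∀ i, 0 < D i := fun i => by
    rw [← hpair]
    exact add_pos (hu₀ _) (hu₀ _)
  set η : m → ℝ := fun i => p₀ (i, 0) + p₀ (i, 1) with hη
  have h0 : Approaches β u₀ p₀ (fun δ x => if x.2 = 0 then (1 - δ) * D x.1 else δ * D x.1)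
      (fun x => if x.2 = 0 then η x.1 else 0) := by
    have := (Approaches.refl (β := β) (p₀ := p₀) hu₀).split_pairs hβ
      (θ := fun δ _ => 1 - δ) (θ₀ := fun _ => 1) (by
        filter_upwards [eventually_small] with δ hδ i
        constructor <;> linarith [hδ.1, hδ.2])
      (fun i => tendsto_eval_zero (by fun_prop) (by simp))
    refine this.congr (Eventually.of_forall fun δ => ?_) ?_
    · ext x
      rw [hpair]
      split_ifs <;> ring
    · ext x
      split_ifs <;> simp [hη]
  -- The second level of pair `l` is the carrier and must stay almost empty, so row `l` of the plan
  -- waits in the first levels while all other rows are delivered to second levels.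
  have h1 := approaches_transport hβ hD hT hcol l h0 (Finset.univ.filter fun a => a.1 ≠ l)
    (by simp)
  simp only [outflow_filter, inflow_filter, hcol, Pi.one_apply, mul_one, hrow] at h1
  have h2 := approaches_collect (D := D) hβ hD hT l
    (v := fun δ i => δ * D i + (1 - 2 * δ) * if i = l then 0 else D i)
    (r := fun i => if i = l then 0 else ∑ j, T i j * (η j / D j)) (s := fun j => η j / D j)
    (by simp) (by simp) (h1.congr (Eventually.of_forall fun δ => by
      ext x
      split_ifs <;> ring) (by
      ext x
      have := hD x.1
      split_ifs
      · field_simp; ring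
      · rfl
      · rfl)) (Finset.univ.erase l) (by simp)
  have hsum : ∀ f : m → ℝ, f l + ∑ j ∈ Finset.univ.erase l, f j = ∑ j, f j := fun f =>
    Finset.add_sum_erase _ _ (Finset.mem_univ l)
  -- Every pair again has joint weight `D i`, so splitting it in the initial ratio returns exactly
  -- to the weights `u₀`, for each `δ` and not only in the limit.
  have h3 := h2.split_pairs hβ (θ := fun _ i => u₀ (i, 0) / D i) (θ₀ := fun i => u₀ (i, 0) / D i)
    (Eventually.of_forall fun δ i => ⟨div_pos (hu₀ _) (hD i), (div_lt_one (hD i)).2 (by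
      rw [← hpair]; linarith [hu₀ (i, 1)])⟩) (fun i => tendsto_const_nhds)
  have h4 := h3.congr (u' := fun _ => u₀) (Eventually.of_forall fun δ => by
    ext ⟨i, b⟩
    have hDi := hD i
    have h5 : 1 - u₀ (i, 0) / D i = u₀ (i, 1) / D i := by
      rw [← hpair i] at hDi ⊢
      field_simp
      ring
    simp only [one_ne_zero, if_true, if_false, hsum, hrow, Finset.mem_erase, Finset.mem_univ,
      and_true, h5]
    by_cases hi : i = l
    · subst hi
      fin_cases b <;> simp <;> field_simp <;> ring
    · fin_cases b <;> simp [hi] <;> field_simp <;> ring) rfl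
  obtain ⟨-, q, hq, hlim⟩ := h4
  refine ⟨q, hq, fun i => ?_⟩
  have h5 := (hlim (i, 0)).add (hlim (i, 1))
  convert h5 using 2
  simp only [one_ne_zero, if_true, if_false, Finset.mem_erase, Finset.mem_univ, and_true]
  by_cases hi : i = l
  · subst hi
    simp
    ring
  · simp [hi]
    ring

end pairs

/-! ### Cumulative sums, majorization and curves. -/

section

variable {n : ℕ}

/-- The sum of the first `k` of the numbers listed by `f`. -/
def cum (f : Fin n → ℝ) (k : ℕ) : ℝ := ∑ i : Fin n with i.val < k, f i

theorem cum_zero (f : Fin n → ℝ) : cum f 0 = 0 := by simp [cum]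

theorem cum_of_le (f : Fin n → ℝ) {k : ℕ} (hk : n ≤ k) : cum f k = ∑ i, f i := by
  rw [cum, Finset.filter_true_of_mem]
  exact fun i _ => i.2.trans_le hk

theorem cum_succ (f : Fin n → ℝ) (i : Fin n) : cum f (i + 1) = cum f i + f i := by
  have : (Finset.univ.filter fun j : Fin n => j.val < i.val + 1) =
      insert i (Finset.univ.filter fun j : Fin n => j.val < i.val) := by
    ext j
    simp [Fin.ext_iff]
    omega
  rw [cum, this, Finset.sum_insert (by simp), cum]
  ring

theorem cum_telescope (g : ℕ → ℝ) {k : ℕ} (hk : k ≤ n) :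
    cum (fun i : Fin n => g (i + 1) - g i) k = g k - g 0 := by
  induction k with
  | zero => simp [cum_zero]
  | succ k ih =>
    have := cum_succ (fun i : Fin n => g (i + 1) - g i) ⟨k, hk⟩
    simp only at this
    rw [this, ih (by omega)]
    ring

theorem sum_telescope (g : ℕ → ℝ) : ∑ i : Fin n, (g (i + 1) - g i) = g n - g 0 := by
  rw [← cum_telescope g le_rfl, cum_of_le _ le_rfl]

theorem cum_mono {f : Fin n → ℝ} (hf : ∀ i, 0 ≤ f i) : Monotone (cum f) := by
  intro k l hkl
  refine Finset.sum_le_sum_of_subset_of_nonneg (fun i hi => ?_) fun i _ _ => hf i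
  simp only [Finset.mem_filter, Finset.mem_univ, true_and] at hi ⊢
  omega

theorem cum_strictMono {f : Fin n → ℝ} (hf : ∀ i, 0 < f i) {k l : ℕ} (hkl : k < l) (hk : k < n) :
    cum f k < cum f l := by
  have h1 := cum_succ f ⟨k, hk⟩
  have h2 := cum_mono (fun i => (hf i).le) (Nat.succ_le_of_lt hkl)
  have h3 := hf ⟨k, hk⟩
  simp only [Nat.succ_eq_add_one] at h1 h2
  linarith

theorem IsBetaOrder.mul_le_mul {β : ℝ} {E q : Fin n → ℝ} {π : Equiv.Perm (Fin n)}
    (h : IsBetaOrder β E q π) {i j : Fin n} (hij : i ≤ j) :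
    Real.exp (-β * E (π i)) * q (π j) ≤ Real.exp (-β * E (π j)) * q (π i) := by
  have h1 := h hij
  simp only at h1
  have h2 := mul_le_mul_of_nonneg_left h1
    (mul_pos (Real.exp_pos (-β * E (π i))) (Real.exp_pos (-β * E (π j)))).le
  have h3 : ∀ x, Real.exp (-β * x) * Real.exp (β * x) = 1 := fun x => by
    rw [← Real.exp_add]; simp
  linear_combination h2 - Real.exp (-β * E (π i)) * q (π j) * h3 (E (π j)) +
    Real.exp (-β * E (π j)) * q (π i) * h3 (E (π i))

theorem exists_isBetaOrder (β : ℝ) (E q : Fin n → ℝ) : ∃ π, IsBetaOrder β E q π := by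
  refine ⟨Tuple.sort fun i => -(q i * Real.exp (β * E i)), fun i j hij => ?_⟩
  have := Tuple.monotone_sort (fun i => -(q i * Real.exp (β * E i))) hij
  simpa using this

/-- A Partial Level Thermalization of two levels moves the population `d` from `j` to `k`. -/
theorem Steers.move {ι : Type} [Fintype ι] [DecidableEq ι] (β : ℝ) (E p : ι → ℝ) {j k : ι}
    (hjk : j ≠ k) {d : ℝ} (hd : 0 < d)
    (hle : Real.exp (-β * E j) * (p k + d) ≤ Real.exp (-β * E k) * (p j - d)) :
    Steers β E p E (fun x => if x = j then p j - d else if x = k then p k + d else p x) := by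
  set uj := Real.exp (-β * E j) with huj
  set uk := Real.exp (-β * E k) with huk
  have hujp : 0 < uj := Real.exp_pos _
  have hukp : 0 < uk := Real.exp_pos _
  have hm : d * (uj + uk) ≤ uk * p j - uj * p k := by linarith
  have hm0 : 0 < uk * p j - uj * p k := by
    have : 0 < d * (uj + uk) := by positivity
    linarith
  -- Full thermalization would move `(uk p j - uj p k) / (uj + uk)` from `j` to `k`. The parameter
  -- is the fraction of this that `d` makes up, and `hle` says that it is at most one.
  obtain ⟨lam, hlam⟩ : ∃ lam, lam = d * (uj + uk) / (uk * p j - uj * p k) := ⟨_, rfl⟩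
  have hlam0 : 0 ≤ lam := by rw [hlam]; positivity
  have hlam1 : lam ≤ 1 := by rw [hlam]; exact (div_le_one hm0).2 hm
  rw [eq_div_iff hm0.ne'] at hlam
  have h := Steers.plt β E p {j, k} hlam0 hlam1
  convert h using 1
  have hS : uj + uk ≠ 0 := by positivity
  ext x
  simp only [thermalizePop, Finset.mem_insert, Finset.mem_singleton, Finset.sum_pair hjk,
    ← huj, ← huk]
  by_cases hxj : x = j
  · subst hxj
    simp only [true_or, if_true, ← huj]
    field_simp
    linear_combination hlam
  by_cases hxk : x = k
  · subst hxk
    simp only [or_true, if_true, hxj, if_false, ← huk]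
    field_simp
    linear_combination -hlam
  · simp [hxj, hxk]

/-- Majorization along a `β`-ordering of the target can be carried out by Partial Level
Thermalizations. -/
theorem steers_of_cum_le (β : ℝ) (E q : Fin n → ℝ) {π : Equiv.Perm (Fin n)}
    (hq : IsBetaOrder β E q π) (p : Fin n → ℝ) (hsum : ∑ i, p i = ∑ i, q i)
    (hcum : ∀ k, cum (q ∘ π) k ≤ cum (p ∘ π) k) : Steers β E p E q := by
  -- The number of levels that are off target decreases: each move settles a level and unsettles
  -- none.
  induction hN : (Finset.univ.filter fun i => p i ≠ q i).card using Nat.strong_induction_on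
    generalizing p with
  | _ N ih =>
  by_cases hpq : p = q
  · subst hpq; exact Steers.refl _ _ _
  have hdiff : ∀ k, 0 ≤ cum (fun i => p (π i) - q (π i)) k := by
    intro k
    have := hcum k
    simp only [cum, Finset.sum_sub_distrib, Function.comp_apply] at this ⊢
    linarith
  have hneg : ∃ k, p (π k) - q (π k) < 0 := by
    by_contra! hcon
    refine hpq (funext fun i => ?_)
    have h1 : ∑ i, (p i - q i) = 0 := by rw [Finset.sum_sub_distrib, hsum, sub_self]
    have h2 := (Finset.sum_eq_zero_iff_of_nonneg fun i _ => by
      simpa using hcon (π.symm i)).1 h1 i (Finset.mem_univ i)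
    linarith
  -- Level `k` is the first with a deficit in the order of the target. The cumulative inequality at
  -- `k + 1` then demands an earlier level `j` with a surplus.
  obtain ⟨k, hk, hmin⟩ := WellFounded.has_min (wellFounded_lt (α := Fin n))
    {k | p (π k) - q (π k) < 0} hneg
  have hbefore : ∀ i < k, 0 ≤ p (π i) - q (π i) := fun i hi => by
    by_contra! h
    exact hmin i h hi
  have hk' : p (π k) - q (π k) < 0 := hk
  obtain ⟨j, hjk, hj⟩ : ∃ j < k, 0 < p (π j) - q (π j) := by
    by_contra! hcon
    have h1 := hdiff (k + 1)
    rw [cum_succ] at h1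
    have h2 : cum (fun i => p (π i) - q (π i)) k ≤ 0 := Finset.sum_nonpos fun i hi => by
      simp only [Finset.mem_filter, Finset.mem_univ, true_and] at hi
      exact hcon i hi
    linarith
  set d := min (p (π j) - q (π j)) (q (π k) - p (π k)) with hd
  have hd0 : 0 < d := lt_min hj (by linarith)
  have hdj : d ≤ p (π j) - q (π j) := min_le_left _ _
  have hdk : d ≤ q (π k) - p (π k) := min_le_right _ _
  have hne : π j ≠ π k := fun h => hjk.ne (π.injective h)
  set p' : Fin n → ℝ := fun x => if x = π j then p (π j) - d else
    if x = π k then p (π k) + d else p x with hp'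
  -- Neither level overshoots its target, so the ordering of `q` at `j < k` guarantees that the
  -- moved population still runs towards equilibrium.
  have hmove : Steers β E p E p' := by
    refine Steers.move β E p hne hd0 ?_
    have h1 := hq.mul_le_mul hjk.le
    have h2 : Real.exp (-β * E (π j)) * (p (π k) + d) ≤ Real.exp (-β * E (π j)) * q (π k) := by
      gcongr; linarith
    have h3 : Real.exp (-β * E (π k)) * q (π j) ≤ Real.exp (-β * E (π k)) * (p (π j) - d) := by
      gcongr; linarith
    exact h2.trans (h1.trans h3)
  have hp'i : ∀ i, p' (π i) = p (π i) + ((if i = k then d else 0) - if i = j then d else 0) := by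
    intro i
    simp only [hp', π.injective.eq_iff]
    by_cases h1 : i = j
    · subst h1; simp [hjk.ne]; ring
    by_cases h2 : i = k
    · subst h2; simp [h1]
    · simp [h1, h2]
  refine hmove.trans (ih _ ?_ p' (hmove.1.trans hsum) (fun K => ?_) rfl)
  · rw [← hN]
    refine Finset.card_lt_card (Finset.ssubset_iff_of_subset (fun x hx => ?_) |>.2 ?_)
    · simp only [Finset.mem_filter, Finset.mem_univ, true_and] at hx ⊢
      by_cases h1 : x = π j
      · subst h1; exact fun h => by linarith
      by_cases h2 : x = π k
      · subst h2; exact fun h => by linarith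
      simpa [hp', h1, h2] using hx
    · rcases min_choice (p (π j) - q (π j)) (q (π k) - p (π k)) with h | h
      · refine ⟨π j, ?_, ?_⟩
        · simp only [Finset.mem_filter, Finset.mem_univ, true_and]
          exact fun h => by linarith
        · simp [hp', hd, h]
      · refine ⟨π k, ?_, ?_⟩
        · simp only [Finset.mem_filter, Finset.mem_univ, true_and]
          exact fun h => by linarith
        · simp [hp', hd, h, hne.symm]
  · have hs : cum (p' ∘ π) K = cum (p ∘ π) K +
        ((if k.val < K then d else 0) - if j.val < K then d else 0) := by
      simp only [cum, Function.comp_apply, hp'i, Finset.sum_add_distrib, Finset.sum_sub_distrib,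
        Finset.sum_ite_eq', Finset.mem_filter, Finset.mem_univ, true_and]
    rw [hs]
    have h0 := hcum K
    by_cases h1 : j.val < K
    · by_cases h2 : k.val < K
      · simp [h1, h2, h0]
      · simp only [h1, h2, if_true, if_false]
        -- A cut between `j` and `k` sees only nonnegative differences, so the surplus of `j` alone,
        -- which is at least `d`, bounds their sum from below.
        have h3 : p (π j) - q (π j) ≤ cum (fun i => p (π i) - q (π i)) K := by
          refine Finset.single_le_sum (f := fun i => p (π i) - q (π i)) (fun i hi => ?_) (by simp [h1])
          simp only [Finset.mem_filter, Finset.mem_univ, true_and] at hi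
          refine hbefore i (Fin.lt_def.2 (by omega))
        have h4 : cum (fun i => p (π i) - q (π i)) K = cum (p ∘ π) K - cum (q ∘ π) K := by
          simp [cum, Finset.sum_sub_distrib]
        linarith
    · have hlt : j.val < k.val := hjk
      have h2 : ¬ k.val < K := by omega
      simp [h1, h2, h0]

/-! ### The curve as a function -/

section curve

variable (β : ℝ) (E η : Fin n → ℝ) (π : Equiv.Perm (Fin n))

/-- The Boltzmann weight of the first `k` of the levels listed by `π`. -/
def cumWeight (k : ℕ) : ℝ := cum (fun i => Real.exp (-β * E (π i))) k

/-- The height at `x` of the curve of `η` with the levels listed by `π`. -/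
def curveHeight (x : ℝ) : ℝ :=
  ∑ l : Fin n, (min x (cumWeight β E π (l + 1)) - min x (cumWeight β E π l)) *
    (η (π l) / Real.exp (-β * E (π l)))

variable {β E η π}

theorem cumWeight_mono : Monotone (cumWeight β E π) := cum_mono fun _ => (Real.exp_pos _).le

theorem cumWeight_zero : cumWeight β E π 0 = 0 := cum_zero _

theorem cumWeight_card : cumWeight β E π n = partition β E := by
  rw [cumWeight, cum_of_le _ le_rfl, partition]
  exact Equiv.sum_comp π fun i => Real.exp (-β * E i)

theorem cumWeight_succ (l : Fin n) :
    cumWeight β E π (l + 1) = cumWeight β E π l + Real.exp (-β * E (π l)) :=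
  cum_succ _ l

/-- Segments left of `x` enter the sum with their full length, those right of it with length zero,
and segment `l` with the part up to `x`. -/
theorem curveHeight_eq {x : ℝ} {l : Fin n} (h0 : cumWeight β E π l ≤ x)
    (h1 : x ≤ cumWeight β E π (l + 1)) :
    curveHeight β E η π x = cum (η ∘ π) l +
      (x - cumWeight β E π l) * (η (π l) / Real.exp (-β * E (π l))) := by
  have hterm : ∀ i : Fin n, (min x (cumWeight β E π (i + 1)) - min x (cumWeight β E π i)) *
      (η (π i) / Real.exp (-β * E (π i))) = (if i.val < l.val then η (π i) else 0) +
        if i = l then (x - cumWeight β E π l) * (η (π l) / Real.exp (-β * E (π l))) else 0 := by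
    intro i
    rcases lt_trichotomy i l with h | h | h
    · have h2 : cumWeight β E π (i + 1) ≤ x := (cumWeight_mono h).trans h0
      have h3 : cumWeight β E π i ≤ x := (cumWeight_mono (Nat.le_succ _)).trans h2
      rw [min_eq_right h2, min_eq_right h3, if_pos (Fin.lt_def.1 h), if_neg h.ne, cumWeight_succ]
      field_simp
      ring
    · subst h
      rw [min_eq_left h1, min_eq_right h0]
      simp
    · have h2 : x ≤ cumWeight β E π i := h1.trans (cumWeight_mono h)
      have h3 : x ≤ cumWeight β E π (i + 1) := h2.trans (cumWeight_mono (Nat.le_succ _))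
      rw [min_eq_left h2, min_eq_left h3, if_neg (by rw [Fin.lt_def] at h; omega), if_neg h.ne']
      simp
  rw [curveHeight, Finset.sum_congr rfl fun i _ => hterm i, Finset.sum_add_distrib,
    ← Finset.sum_filter]
  simp [cum]

theorem exists_segment {x : ℝ} (h0 : 0 ≤ x) (h1 : x < partition β E) :
    ∃ l : Fin n, cumWeight β E π l ≤ x ∧ x ≤ cumWeight β E π (l + 1) := by
  have hex : ∃ k, x < cumWeight β E π k := ⟨n, by rwa [cumWeight_card]⟩
  classical
  have hk := Nat.find_spec hex
  have hmin := fun m => Nat.find_min hex (m := m)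
  set k := Nat.find hex
  have hk0 : k ≠ 0 := by
    intro h
    rw [h, cumWeight_zero] at hk
    linarith
  have hkn : k ≤ n := Nat.find_min' hex (by rwa [cumWeight_card])
  refine ⟨⟨k - 1, by omega⟩, ?_, ?_⟩
  · exact not_lt.1 (hmin (k - 1) (by omega))
  · simp only
    rw [Nat.sub_add_cancel (Nat.one_le_iff_ne_zero.2 hk0)]
    exact hk.le

theorem mem_diagonalCurve (hπ : IsBetaOrder β E η π) {x : ℝ} (h0 : 0 ≤ x)
    (h1 : x < partition β E) : (x, curveHeight β E η π x) ∈ diagonalCurve β E η := by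
  obtain ⟨l, hl0, hl1⟩ := exists_segment (π := π) h0 h1
  refine ⟨π, hπ, l, l.2, ?_⟩
  rw [segment_eq_image]
  have hu := Real.exp_pos (-β * E (π l))
  refine ⟨(x - cumWeight β E π l) / Real.exp (-β * E (π l)), ⟨by
    have := sub_nonneg.2 hl0
    positivity, ?_⟩, ?_⟩
  · rw [div_le_one hu]
    rw [cumWeight_succ] at hl1
    linarith
  · have e1 : curvePoint β E η π l = (cumWeight β E π l, cum (η ∘ π) l) := rfl
    have e2 : curvePoint β E η π (l + 1) = (cumWeight β E π (l + 1), cum (η ∘ π) (l + 1)) := rfl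
    rw [e1, e2, curveHeight_eq hl0 hl1, cumWeight_succ, cum_succ]
    ext
    · simp only [Prod.smul_mk, Prod.mk_add_mk, smul_eq_mul]
      field_simp
      ring
    · simp only [Prod.smul_mk, Prod.mk_add_mk, smul_eq_mul, Function.comp_apply]
      field_simp
      ring

theorem cum_mem_diagonalCurve (hπ : IsBetaOrder β E η π) {k : ℕ} (hk : k < n) :
    (cumWeight β E π k, cum (η ∘ π) k) ∈ diagonalCurve β E η :=
  ⟨π, hπ, k, hk, left_mem_segment ℝ _ _⟩

/-- The excess `∑ i, (η i - t e ^ (-β E i))⁺`. -/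
def excess (β : ℝ) (E η : Fin n → ℝ) (t : ℝ) : ℝ := ∑ i, max (η i - t * Real.exp (-β * E i)) 0

/-- Attainment in Legendre duality: for `t` the slope of the segment over `x`, the positive parts
come only from levels before that segment, and the line of slope `t` with intercept `excess`
contains the segment. -/
theorem exists_excess_eq (hπ : IsBetaOrder β E η π) {x : ℝ} (h0 : 0 ≤ x) (h1 : x < partition β E) :
    ∃ t, excess β E η t + t * x = curveHeight β E η π x := by
  obtain ⟨l, hl0, hl1⟩ := exists_segment (π := π) h0 h1
  refine ⟨η (π l) / Real.exp (-β * E (π l)), ?_⟩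
  rw [curveHeight_eq hl0 hl1]
  have hterm : ∀ i : Fin n, max (η (π i) - η (π l) / Real.exp (-β * E (π l)) *
      Real.exp (-β * E (π i))) 0 = if i.val < l.val then (η (π i) - η (π l) /
        Real.exp (-β * E (π l)) * Real.exp (-β * E (π i))) else 0 := by
    intro i
    have hu := Real.exp_pos (-β * E (π l))
    split_ifs with h
    · refine max_eq_left ?_
      have := hπ.mul_le_mul (Fin.le_def.2 h.le)
      rw [sub_nonneg, div_mul_eq_mul_div, div_le_iff₀ hu]
      linarith
    · refine max_eq_right ?_
      have := hπ.mul_le_mul (i := l) (j := i) (Fin.le_def.2 (not_lt.1 h))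
      rw [sub_nonpos, div_mul_eq_mul_div, le_div_iff₀ hu]
      linarith
  have : excess β E η (η (π l) / Real.exp (-β * E (π l))) = cum (η ∘ π) l -
      η (π l) / Real.exp (-β * E (π l)) * cumWeight β E π l := by
    rw [excess, ← Equiv.sum_comp π, Finset.sum_congr rfl fun i _ => hterm i, ← Finset.sum_filter,
      Finset.sum_sub_distrib, ← Finset.mul_sum]
    rfl
  rw [this]
  ring

/-- The other half of the duality: a partial sum of signed differences is at most the sum of all
positive parts. No ordering of the levels is needed. -/
theorem cum_le_excess (ζ : Fin n → ℝ) (t : ℝ) (k : ℕ) :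
    cum (ζ ∘ π) k ≤ excess β E ζ t + t * cumWeight β E π k := by
  have h1 : cum (fun i => ζ (π i) - t * Real.exp (-β * E (π i))) k ≤ excess β E ζ t := by
    rw [excess, ← Equiv.sum_comp π]
    refine (Finset.sum_le_sum fun i _ => le_max_left _ 0).trans
      (Finset.sum_le_sum_of_subset_of_nonneg (Finset.subset_univ _) fun i _ _ => le_max_right _ _)
  have h2 : cum (fun i => ζ (π i) - t * Real.exp (-β * E (π i))) k =
      cum (ζ ∘ π) k - t * cumWeight β E π k := by
    simp only [cum, cumWeight, Finset.sum_sub_distrib, Finset.mul_sum, Function.comp_apply]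
  linarith

end curve

/-- This mixed difference is the length of the overlap of the intervals `[a, a']` and `[b, b']`. -/
theorem min_supermodular {a a' b b' : ℝ} (ha : a ≤ a') (hb : b ≤ b') :
    0 ≤ (min a' b' - min a' b) - (min a b' - min a b) := by
  rcases le_total a b with h1 | h1 <;> rcases le_total a' b' with h2 | h2 <;>
    rcases le_total a b' with h3 | h3 <;> rcases le_total a' b with h4 | h4 <;>
    simp [h1, h2, h3, h4] <;> linarith

/-- The transport plan between two orderings of the levels that fills up the levels in the second
order by the levels in the first: its result has the heights of the curve as cumulative sums. -/
theorem exists_transport (β : ℝ) (E η : Fin n → ℝ) (π π' : Equiv.Perm (Fin n)) :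
    ∃ T : Fin n → Fin n → ℝ, (∀ i j, 0 ≤ T i j) ∧ (∀ i, ∑ j, T i j = Real.exp (-β * E i)) ∧
      (∀ j, ∑ i, T i j = Real.exp (-β * E j)) ∧
      ∀ k ≤ n, cum ((fun i => ∑ j, T i j * (η j / Real.exp (-β * E j))) ∘ π') k =
        curveHeight β E η π (cumWeight β E π' k) := by
  set A := cumWeight β E π'
  set B := cumWeight β E π
  have hA : Monotone A := cumWeight_mono
  have hB : Monotone B := cumWeight_mono
  have hA0 : A 0 = 0 := cumWeight_zero
  have hB0 : B 0 = 0 := cumWeight_zero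
  have hAB : A n = B n := by simp only [A, B, cumWeight_card]
  have hAn : ∀ k : ℕ, k ≤ n → min (A k) (B n) = A k := fun k hk =>
    min_eq_left (hAB ▸ hA hk)
  have hBn : ∀ k : ℕ, k ≤ n → min (A n) (B k) = B k := fun k hk =>
    min_eq_right (hAB ▸ hB hk)
  have hAz : ∀ k : ℕ, min (A k) (B 0) = 0 := fun k => by
    rw [hB0, ← hA0]; exact min_eq_right (hA (Nat.zero_le _))
  have hBz : ∀ k : ℕ, min (A 0) (B k) = 0 := fun k => by
    rw [hA0, ← hB0]; exact min_eq_left (hB (Nat.zero_le _))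
  -- The monotone coupling: the overlap of the `k`-th interval of the subdivision by `π'` with the
  -- `l`-th of the subdivision by `π`. As a mixed difference of `min` it telescopes in both indices.
  set T₀ : Fin n → Fin n → ℝ := fun k l =>
    (min (A (k + 1)) (B (l + 1)) - min (A (k + 1)) (B l)) -
      (min (A k) (B (l + 1)) - min (A k) (B l)) with hT₀
  refine ⟨fun i j => T₀ (π'.symm i) (π.symm j), fun i j => ?_, fun i => ?_, fun j => ?_,
    fun k hk => ?_⟩
  · exact min_supermodular (hA (Nat.le_succ _)) (hB (Nat.le_succ _))
  · rw [← Equiv.sum_comp π]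
    simp only [Equiv.symm_apply_apply, hT₀]
    rw [Finset.sum_sub_distrib, sum_telescope fun l => min (A (π'.symm i + 1)) (B l),
      sum_telescope fun l => min (A (π'.symm i)) (B l), hAz, hAz, hAn _ (π'.symm i).2,
      hAn _ (π'.symm i).2.le]
    simp only [A, cumWeight_succ, Equiv.apply_symm_apply]
    ring
  · rw [← Equiv.sum_comp π']
    simp only [Equiv.symm_apply_apply, hT₀]
    rw [sum_telescope fun k => min (A k) (B (π.symm j + 1)) - min (A k) (B (π.symm j)), hBz, hBz,
      hBn _ (π.symm j).2, hBn _ (π.symm j).2.le]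
    simp only [B, cumWeight_succ, Equiv.apply_symm_apply]
    ring
  · have h1 : ((fun i => ∑ j, T₀ (π'.symm i) (π.symm j) * (η j / Real.exp (-β * E j))) ∘ π') =
        fun i => ∑ l, T₀ i l * (η (π l) / Real.exp (-β * E (π l))) := by
      ext i
      simp only [Function.comp_apply, Equiv.symm_apply_apply]
      rw [← Equiv.sum_comp π]
      simp
    rw [h1, cum, Finset.sum_comm, curveHeight]
    refine Finset.sum_congr rfl fun l _ => ?_
    rw [← Finset.sum_mul]
    congr 1
    have := cum_telescope (fun k => min (A k) (B (l + 1)) - min (A k) (B l)) hk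
    rw [hBz, hBz, sub_self, sub_zero] at this
    exact this

end

/-! ### Energy-conserving matrices and block diagonalization. -/

section hamiltonian

variable {ι : Type} [Fintype ι] [DecidableEq ι]

theorem commute_hamiltonian_iff {E : ι → ℝ} {M : Matrix ι ι ℂ} :
    Commute M (hamiltonian E) ↔ ∀ i j, E i ≠ E j → M i j = 0 := by
  unfold Commute SemiconjBy hamiltonian
  rw [← Matrix.ext_iff]
  simp only [Matrix.mul_diagonal, Matrix.diagonal_mul]
  refine forall₂_congr fun i j => ?_
  constructor
  · intro h hE
    have h2 : M i j * ((E j : ℂ) - E i) = 0 := by rw [mul_sub, h]; ring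
    refine (mul_eq_zero.1 h2).resolve_right fun h3 => hE ?_
    exact_mod_cast (sub_eq_zero.1 h3).symm
  · intro h
    by_cases hE : E i = E j
    · rw [hE, mul_comm]
    · rw [h hE]; simp

theorem commute_conjTranspose {E : ι → ℝ} {M : Matrix ι ι ℂ} (h : Commute M (hamiltonian E)) :
    Commute Mᴴ (hamiltonian E) := by
  rw [commute_hamiltonian_iff] at h ⊢
  intro i j hij
  rw [Matrix.conjTranspose_apply, h j i hij.symm, star_zero]

theorem sum_normSq_row {U : Matrix ι ι ℂ} (hU : U ∈ Matrix.unitaryGroup ι ℂ) (i : ι) :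
    ∑ j, Complex.normSq (U i j) = 1 := by
  have h := congrFun (congrFun (Matrix.mem_unitaryGroup_iff.1 hU) i) i
  simp only [Matrix.mul_apply, Matrix.star_apply, Matrix.one_apply_eq, RCLike.star_def,
    Complex.mul_conj] at h
  exact_mod_cast h

theorem sum_normSq_col {U : Matrix ι ι ℂ} (hU : U ∈ Matrix.unitaryGroup ι ℂ) (j : ι) :
    ∑ i, Complex.normSq (U i j) = 1 := by
  have h := congrFun (congrFun (Matrix.mem_unitaryGroup_iff'.1 hU) j) j
  simp only [Matrix.mul_apply, Matrix.star_apply, Matrix.one_apply_eq, RCLike.star_def,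
    mul_comm ((starRingEnd ℂ) _), Complex.mul_conj] at h
  exact_mod_cast h

/-- The spectral theorem is applied inside each colour class and the eigenvector matrices are
assembled along the fibres of `c`. With colours given by energies, this yields an eigenbasis shared
with the Hamiltonian. -/
theorem exists_block_diagonalization {κ : Type} [Fintype κ] [DecidableEq κ] (c : ι → κ)
    {A : Matrix ι ι ℂ} (hA : A.IsHermitian) (hc : ∀ i j, c i ≠ c j → A i j = 0) :
    ∃ V ∈ Matrix.unitaryGroup ι ℂ, (∀ i j, c i ≠ c j → V i j = 0) ∧
      ∃ η : ι → ℝ, A = V * Matrix.diagonal (fun i => (η i : ℂ)) * Vᴴ := by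
  classical
  set e := Equiv.sigmaFiberEquiv c
  have hB : ∀ b, (A.submatrix (fun x : {i // c i = b} => x.1) (fun x => x.1)).IsHermitian :=
    fun b => hA.submatrix _
  set U : ∀ b, Matrix {i // c i = b} {i // c i = b} ℂ := fun b => (hB b).eigenvectorUnitary
  set V := (Matrix.blockDiagonal' U).submatrix e.symm e.symm
  have hU : ∀ b, U b * (U b)ᴴ = 1 := fun b =>
    Matrix.mem_unitaryGroup_iff.1 (hB b).eigenvectorUnitary.2
  set B := Matrix.blockDiagonal' fun b =>
    A.submatrix (fun x : {i // c i = b} => x.1) (fun x : {i // c i = b} => x.1) with hBdef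
  have hAe : A = B.submatrix e.symm e.symm := by
    have : A.submatrix e e = B := by
      ext ⟨b, i, hi⟩ ⟨b', j, hj⟩
      by_cases h : b = b'
      · subst h
        rw [hBdef, Matrix.blockDiagonal'_apply_eq]
        rfl
      · rw [hBdef, Matrix.blockDiagonal'_apply_ne _ _ _ h]
        exact hc i j (by rw [hi, hj]; exact h)
    rw [← this]
    simp
  have hspec : B = Matrix.blockDiagonal' U *
      Matrix.diagonal (fun x : Σ b, {i // c i = b} => ((hB x.1).eigenvalues x.2 : ℂ)) *
      (Matrix.blockDiagonal' U)ᴴ := by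
    rw [Matrix.blockDiagonal'_conjTranspose, ← Matrix.blockDiagonal'_diagonal
      (fun b x => ((hB b).eigenvalues x : ℂ)), ← Matrix.blockDiagonal'_mul,
      ← Matrix.blockDiagonal'_mul, hBdef]
    congr 1
    ext1 b
    conv_lhs => rw [(hB b).spectral_theorem, Unitary.conjStarAlgAut_apply]
    rfl
  refine ⟨V, ?_, fun i j hij => Matrix.blockDiagonal'_apply_ne U ⟨i, rfl⟩ ⟨j, rfl⟩ hij,
    fun i => (hB (c i)).eigenvalues ⟨i, rfl⟩, ?_⟩
  · rw [Matrix.mem_unitaryGroup_iff, Matrix.star_eq_conjTranspose, Matrix.conjTranspose_submatrix,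
      Matrix.submatrix_mul_equiv, Matrix.blockDiagonal'_conjTranspose, ← Matrix.blockDiagonal'_mul]
    simp_rw [hU]
    change (Matrix.blockDiagonal' (1 : ∀ b, Matrix {i // c i = b} {i // c i = b} ℂ)).submatrix _ _ = 1
    rw [Matrix.blockDiagonal'_one, Matrix.submatrix_one_equiv]
  · conv_lhs => rw [hAe, hspec]
    rw [← Matrix.submatrix_mul_equiv _ _ _ e.symm, ← Matrix.submatrix_mul_equiv _ _ _ e.symm,
      ← Matrix.conjTranspose_submatrix, Matrix.submatrix_diagonal_equiv]
    rfl

theorem conjugate_cancel {V : Matrix ι ι ℂ} (hV : V ∈ Matrix.unitaryGroup ι ℂ) (X : Matrix ι ι ℂ) :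
    Vᴴ * (V * X * Vᴴ) * V = X := by
  have h : Vᴴ * V = 1 := Matrix.mem_unitaryGroup_iff'.1 hV
  calc _ = (Vᴴ * V) * X * (Vᴴ * V) := by simp only [Matrix.mul_assoc]
    _ = X := by rw [h, Matrix.one_mul, Matrix.mul_one]

theorem cancel_conjugate {V : Matrix ι ι ℂ} (hV : V ∈ Matrix.unitaryGroup ι ℂ) (X : Matrix ι ι ℂ) :
    V * (Vᴴ * X * V) * Vᴴ = X := by
  have h : V * Vᴴ = 1 := Matrix.mem_unitaryGroup_iff.1 hV
  calc _ = (V * Vᴴ) * X * (V * Vᴴ) := by simp only [Matrix.mul_assoc]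
    _ = X := by rw [h, Matrix.one_mul, Matrix.mul_one]

end hamiltonian

/-! ### Populations and dephasing. -/

section decohere

variable {n : ℕ} {E : Fin n → ℝ} {ρ : Matrix (Fin n) (Fin n) ℂ}

theorem decohere_eq_self (h : IsBlockDiagonal E ρ) : decohere E ρ = ρ := by
  ext i j
  simp only [decohere, Matrix.of_apply]
  split_ifs with hij
  · rfl
  · exact (commute_hamiltonian_iff.1 h i j hij).symm

theorem exists_isPopulation (hρ : ρ.IsHermitian) : ∃ η, IsPopulation E ρ η := by
  rcases isEmpty_or_nonempty (Fin n) with hn | hn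
  · exact ⟨0, 1, one_mem _, Commute.one_left _, Subsingleton.elim _ _⟩
  -- Colours must form a finite type, so each energy is represented by a chosen level that has it.
  set c : Fin n → Fin n := fun i => Function.invFun E (E i)
  have hc : ∀ i, E (c i) = E i := fun i => Function.invFun_eq ⟨i, rfl⟩
  have hne : ∀ i j, c i ≠ c j → E i ≠ E j := fun i j h hE => h (by simp only [c, hE])
  have hherm : (decohere E ρ).IsHermitian := by
    ext i j
    simp only [decohere, Matrix.conjTranspose_apply, Matrix.of_apply, eq_comm (a := E j)]
    split_ifs
    · exact hρ.apply i j
    · simp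
  obtain ⟨V, hV, hVc, η, hη⟩ := exists_block_diagonalization c hherm
    (fun i j h => by simp [decohere, hne i j h])
  refine ⟨η, V, hV, commute_hamiltonian_iff.2 fun i j hE => hVc i j fun h => hE ?_, hη⟩
  rw [← hc i, ← hc j, h]

/-- A matrix commuting with the Hamiltonian mixes only levels of equal energy, so conjugation
respects the energy blocks. -/
theorem decohere_conjugate {V : Matrix (Fin n) (Fin n) ℂ} (hV : Commute V (hamiltonian E)) :
    decohere E (Vᴴ * ρ * V) = Vᴴ * decohere E ρ * V := by
  have h1 := commute_hamiltonian_iff.1 hV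
  have h2 := commute_hamiltonian_iff.1 (commute_conjTranspose hV)
  ext i j
  simp only [decohere, Matrix.of_apply, Matrix.mul_apply, Finset.sum_mul]
  split_ifs with hij
  · refine Finset.sum_congr rfl fun y _ => Finset.sum_congr rfl fun x _ => ?_
    split_ifs with hxy
    · rfl
    · by_cases hx : E i = E x
      · rw [h1 y j fun hy => hxy (by rw [← hx, hij, hy])]
        simp
      · rw [h2 i x hx]
        simp
  · symm
    refine Finset.sum_eq_zero fun y _ => Finset.sum_eq_zero fun x _ => ?_
    split_ifs with hxy
    · by_cases hx : E i = E x
      · rw [h1 y j fun hy => hij (by rw [hx, hxy, hy])]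
        simp
      · rw [h2 i x hx]
        simp
    · simp

/-- The populations are the diagonal elements in the eigenbasis. -/
theorem decohere_conjugate_eq_diagonal {V : Matrix (Fin n) (Fin n) ℂ} {η : Fin n → ℝ}
    (hV : V ∈ Matrix.unitaryGroup (Fin n) ℂ) (hVE : Commute V (hamiltonian E))
    (h : decohere E ρ = V * Matrix.diagonal (fun i => (η i : ℂ)) * Vᴴ) :
    decohere E (Vᴴ * ρ * V) = Matrix.diagonal fun i => (η i : ℂ) := by
  rw [decohere_conjugate hVE, h, conjugate_cancel hV]

theorem conjugate_apply_self {V : Matrix (Fin n) (Fin n) ℂ} {η : Fin n → ℝ}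
    (hV : V ∈ Matrix.unitaryGroup (Fin n) ℂ) (hVE : Commute V (hamiltonian E))
    (h : decohere E ρ = V * Matrix.diagonal (fun i => (η i : ℂ)) * Vᴴ) (i : Fin n) :
    (Vᴴ * ρ * V) i i = η i := by
  have := congrFun (congrFun (decohere_conjugate_eq_diagonal hV hVE h) i) i
  simpa [decohere] using this

theorem IsPopulation.nonneg {η : Fin n → ℝ} (hρ : IsState ρ) (h : IsPopulation E ρ η) (i : Fin n) :
    0 ≤ η i := by
  obtain ⟨V, hV, hVE, h⟩ := h
  have h1 := (hρ.1.conjTranspose_mul_mul_same V).diag_nonneg (i := i)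
  rw [conjugate_apply_self hV hVE h] at h1
  exact_mod_cast h1

theorem IsPopulation.sum_eq_one {η : Fin n → ℝ} (hρ : IsState ρ) (h : IsPopulation E ρ η) :
    ∑ i, η i = 1 := by
  obtain ⟨V, hV, hVE, h⟩ := h
  have h1 : (Vᴴ * ρ * V).trace = 1 := by
    rw [Matrix.trace_mul_cycle, show V * Vᴴ = 1 from Matrix.mem_unitaryGroup_iff.1 hV,
      Matrix.one_mul, hρ.2]
  simp only [Matrix.trace, Matrix.diag, conjugate_apply_self hV hVE h] at h1
  exact_mod_cast h1

/-- Decoherence is a uniform mixture of phase shifts of the energy levels. -/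
theorem exists_mixUnitary_eq_decohere (E : Fin n → ℝ) (hn : 0 < n) :
    ∃ (p : Fin n → ℝ) (U : Fin n → Matrix (Fin n) (Fin n) ℂ), (∀ k, 0 ≤ p k) ∧ ∑ k, p k = 1 ∧
      (∀ k, U k ∈ Matrix.unitaryGroup (Fin n) ℂ ∧ Commute (U k) (hamiltonian E)) ∧
      ∀ ρ, mixUnitary p U ρ = decohere E ρ := by
  have : Nonempty (Fin n) := ⟨⟨0, hn⟩⟩
  have hn' : (n : ℝ) ≠ 0 := by positivity
  set c : Fin n → Fin n := fun i => Function.invFun E (E i)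
  have hc : ∀ i, E (c i) = E i := fun i => Function.invFun_eq ⟨i, rfl⟩
  set ω := Complex.exp (2 * Real.pi * Complex.I / n)
  have hω : IsPrimitiveRoot ω n := Complex.isPrimitiveRoot_exp n hn.ne'
  have hnorm : ω * star ω = 1 := by
    rw [RCLike.star_def, Complex.mul_conj, Complex.normSq_eq_norm_sq,
      hω.norm'_eq_one hn.ne']
    simp
  refine ⟨fun _ => 1 / n, fun k => Matrix.diagonal fun i => (ω ^ (c i).val) ^ k.val,
    fun k => by positivity, by simp [hn'], fun k => ⟨?_, ?_⟩, fun ρ => ?_⟩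
  · rw [Matrix.mem_unitaryGroup_iff, Matrix.star_eq_conjTranspose, Matrix.diagonal_conjTranspose,
      Matrix.diagonal_mul_diagonal, ← Matrix.diagonal_one]
    congr 1
    ext i
    rw [Pi.star_apply, star_pow, star_pow, ← mul_pow, ← mul_pow, hnorm, one_pow, one_pow]
  · exact commute_hamiltonian_iff.2 fun i j hij => Matrix.diagonal_apply_ne _ fun h => hij (by rw [h])
  · ext i j
    -- The average multiplies the entry `(i, j)` by `(1/n) ∑ z ^ k`. Here `z` is an `n`-th root of
    -- unity that equals one exactly when the energies agree; otherwise the geometric sum vanishes.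
    set z := ω ^ (c i).val * star (ω ^ (c j).val) with hz
    have hsum : mixUnitary (fun _ => 1 / (n : ℝ))
        (fun k : Fin n => Matrix.diagonal fun i => (ω ^ (c i).val) ^ k.val) ρ i j =
        (1 / n) * (∑ k ∈ Finset.range n, z ^ k) * ρ i j := by
      rw [← Fin.sum_univ_eq_sum_range, Finset.mul_sum, Finset.sum_mul, mixUnitary, Matrix.sum_apply]
      refine Finset.sum_congr rfl fun k _ => ?_
      rw [Matrix.diagonal_conjTranspose, Matrix.smul_apply, Matrix.mul_diagonal,
        Matrix.diagonal_mul, Pi.star_apply, star_pow, hz, mul_pow, smul_eq_mul]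
      push_cast
      ring
    rw [hsum, decohere, Matrix.of_apply]
    have hzc : z = 1 → c i = c j := by
      intro h
      have h2 : ω ^ (c i).val = ω ^ (c j).val := by
        calc ω ^ (c i).val = ω ^ (c i).val * (ω * star ω) ^ (c j).val := by rw [hnorm]; simp
          _ = z * ω ^ (c j).val := by rw [hz, mul_pow, star_pow]; ring
          _ = _ := by rw [h, one_mul]
      exact Fin.ext (hω.pow_inj (c i).2 (c j).2 h2)
    have hnC : (n : ℂ) ≠ 0 := by exact_mod_cast hn.ne'
    split_ifs with hij
    · have hz1 : z = 1 := by
        have : c i = c j := by simp only [c, hij]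
        rw [hz, this, star_pow, ← mul_pow, hnorm, one_pow]
      simp [hz1, hnC]
    · have hz1 : z ≠ 1 := fun h => hij (by rw [← hc i, ← hc j, hzc h])
      have hzn : z ^ n = 1 := by
        have hp : ∀ a : ℕ, (ω ^ a) ^ n = 1 := fun a => by
          rw [← pow_mul, mul_comm, pow_mul, hω.pow_eq_one, one_pow]
        rw [hz, mul_pow, ← star_pow, hp, hp]
        simp
      rw [geom_sum_eq hz1, hzn]
      simp

end decohere

theorem partialTrace_conjugate {ι κ : Type} [Fintype ι] [DecidableEq ι] [Fintype κ] [DecidableEq κ]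
    (A B : Matrix ι ι ℂ) (Y : Matrix (ι × κ) (ι × κ) ℂ) :
    partialTrace ((A ⊗ₖ (1 : Matrix κ κ ℂ)) * Y * (B ⊗ₖ (1 : Matrix κ κ ℂ))) =
      A * partialTrace Y * B := by
  ext i j
  simp only [partialTrace, Matrix.of_apply, Matrix.mul_apply, Matrix.kroneckerMap_apply,
    Fintype.sum_prod_type, Matrix.one_apply, mul_ite, ite_mul, mul_one, mul_zero, zero_mul,
    Finset.sum_ite_eq, Finset.sum_ite_eq', Finset.mem_univ, if_true]
  rw [Finset.sum_comm]
  refine Finset.sum_congr rfl fun y _ => ?_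
  rw [← Finset.sum_mul]
  congr 1
  rw [Finset.sum_comm]
  refine Finset.sum_congr rfl fun x _ => ?_
  rw [Finset.mul_sum]

/-! ### Thermal operations as Gibbs-preserving stochastic matrices. -/

section thermal

variable {n : ℕ} {β : ℝ} {E η : Fin n → ℝ} {ρ : Matrix (Fin n) (Fin n) ℂ}

theorem hamiltonian_add {m : ℕ} (F : Fin m → ℝ) :
    hamiltonian E ⊗ₖ (1 : Matrix (Fin m) (Fin m) ℂ) + (1 : Matrix (Fin n) (Fin n) ℂ) ⊗ₖ hamiltonian F =
      hamiltonian fun x : Fin n × Fin m => E x.1 + F x.2 := by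
  unfold hamiltonian
  rw [← Matrix.diagonal_one, ← Matrix.diagonal_one, Matrix.diagonal_kronecker_diagonal,
    Matrix.diagonal_kronecker_diagonal, Matrix.diagonal_add]
  simp

theorem kronecker_one_mem_unitaryGroup {m : ℕ} {V : Matrix (Fin n) (Fin n) ℂ}
    (hV : V ∈ Matrix.unitaryGroup (Fin n) ℂ) :
    V ⊗ₖ (1 : Matrix (Fin m) (Fin m) ℂ) ∈ Matrix.unitaryGroup (Fin n × Fin m) ℂ := by
  rw [Matrix.mem_unitaryGroup_iff, Matrix.star_eq_conjTranspose, Matrix.conjTranspose_kronecker,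
    ← Matrix.mul_kronecker_mul, ← Matrix.star_eq_conjTranspose, Matrix.mem_unitaryGroup_iff.1 hV]
  simp

theorem kronecker_one_commute {m : ℕ} {V : Matrix (Fin n) (Fin n) ℂ} (F : Fin m → ℝ)
    (hV : Commute V (hamiltonian E)) : Commute (V ⊗ₖ (1 : Matrix (Fin m) (Fin m) ℂ))
      (hamiltonian fun x : Fin n × Fin m => E x.1 + F x.2) := by
  rw [commute_hamiltonian_iff] at hV ⊢
  rintro ⟨i, s⟩ ⟨j, r⟩ h
  rw [Matrix.kroneckerMap_apply]
  by_cases hsr : s = r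
  · subst hsr
    rw [hV i j fun hE => h (by simp [hE]), zero_mul]
  · rw [Matrix.one_apply_ne hsr, mul_zero]

/-- The populations after a thermal operation are obtained from those before it by the matrix
of transition probabilities `∑ s r, |W (i, s) (x, r)|² τ r`. -/
theorem conjugate_diag_re {m : ℕ} (F : Fin m → ℝ) {W : Matrix (Fin n × Fin m) (Fin n × Fin m) ℂ}
    (hW : Commute W (hamiltonian fun x : Fin n × Fin m => E x.1 + F x.2))
    (hρ : decohere E ρ = Matrix.diagonal fun i => (η i : ℂ)) (i : Fin n) :
    (partialTrace (W * (ρ ⊗ₖ gibbs β F) * Wᴴ) i i).re =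
      ∑ x, (∑ s, ∑ r, Complex.normSq (W (i, s) (x, r)) *
        (Real.exp (-β * F r) / partition β F)) * η x := by
  have hW' := commute_hamiltonian_iff.1 hW
  have hentry : ∀ s, (W * (ρ ⊗ₖ gibbs β F) * Wᴴ) (i, s) (i, s) =
      ∑ x, ∑ r, ((Complex.normSq (W (i, s) (x, r)) *
        (Real.exp (-β * F r) / partition β F) * η x : ℝ) : ℂ) := by
    intro s
    rw [Matrix.mul_apply, Fintype.sum_prod_type]
    refine Finset.sum_congr rfl fun y _ => Finset.sum_congr rfl fun r _ => ?_
    rw [Matrix.mul_apply, Fintype.sum_prod_type, Finset.sum_mul, Finset.sum_eq_single y]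
    · rw [Finset.sum_mul, Finset.sum_eq_single r]
      · have : ρ y y = η y := by
          have := congrFun (congrFun hρ y) y
          simpa [decohere] using this
        rw [Matrix.kroneckerMap_apply, this, gibbs, Matrix.diagonal_apply_eq,
          Matrix.conjTranspose_apply, RCLike.star_def]
        push_cast
        rw [← Complex.mul_conj]
        ring
      · intro r' _ hr
        simp [gibbs, Matrix.kroneckerMap_apply, hr]
      · simp
    -- A coherence `ρ x y` contributes only if the amplitudes from `(x, r')` and `(y, r')` to `(i,
    -- s)` are both nonzero. Energy conservation then gives `E x = E y`, and there `ρ` has no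
    -- off-diagonal entries.
    · intro x _ hxy
      rw [Finset.sum_mul]
      refine Finset.sum_eq_zero fun r' _ => ?_
      rw [Matrix.kroneckerMap_apply, gibbs]
      by_cases hr : r' = r
      · subst hr
        by_cases hE : E x = E y
        · have : ρ x y = 0 := by
            have := congrFun (congrFun hρ x) y
            simpa [decohere, hE, hxy] using this
          simp [this]
        · by_cases h1 : E i + F s = E x + F r'
          · rw [Matrix.conjTranspose_apply, hW' (i, s) (y, r') fun h => hE (by
              simp only at h; linarith)]
            simp
          · rw [hW' (i, s) (x, r') h1]
            simp
      · rw [Matrix.diagonal_apply_ne _ hr]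
        simp
    · simp
  simp only [partialTrace, Matrix.of_apply, hentry, Complex.re_sum, Complex.ofReal_re]
  rw [Finset.sum_comm]
  refine Finset.sum_congr rfl fun x _ => ?_
  rw [Finset.sum_mul]
  refine Finset.sum_congr rfl fun s _ => ?_
  rw [Finset.sum_mul]

theorem partition_pos {ι : Type} [Fintype ι] [Nonempty ι] (β : ℝ) (F : ι → ℝ) :
    0 < partition β F :=
  Finset.sum_pos (fun _ _ => Real.exp_pos _) Finset.univ_nonempty

/-- A stochastic matrix that preserves the Boltzmann weights does not increase the excess. -/
theorem excess_mulVec_le {P : Fin n → Fin n → ℝ} (hP : ∀ i j, 0 ≤ P i j)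
    (hcol : ∀ j, ∑ i, P i j = 1)
    (hrow : ∀ i, ∑ j, P i j * Real.exp (-β * E j) = Real.exp (-β * E i)) (t : ℝ) :
    excess β E (fun i => ∑ j, P i j * η j) t ≤ excess β E η t := by
  have h1 : ∀ i, max (∑ j, P i j * η j - t * Real.exp (-β * E i)) 0 ≤
      ∑ j, P i j * max (η j - t * Real.exp (-β * E j)) 0 := by
    intro i
    refine max_le ?_ (Finset.sum_nonneg fun j _ => mul_nonneg (hP i j) (le_max_right _ _))
    rw [← hrow, Finset.mul_sum, ← Finset.sum_sub_distrib]
    refine Finset.sum_le_sum fun j _ => ?_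
    calc _ = P i j * (η j - t * Real.exp (-β * E j)) := by ring
      _ ≤ _ := mul_le_mul_of_nonneg_left (le_max_left _ _) (hP i j)
  calc _ ≤ ∑ i, ∑ j, P i j * max (η j - t * Real.exp (-β * E j)) 0 :=
        Finset.sum_le_sum fun i _ => h1 i
    _ = _ := by
      rw [Finset.sum_comm, excess]
      refine Finset.sum_congr rfl fun j _ => ?_
      rw [← Finset.sum_mul, hcol, one_mul]

/-- Both changes of basis are absorbed into the unitary, so the diagonal evolves by squared
amplitudes averaged over the bath. Unit columns and a normalized bath make this matrix stochastic;
unit rows and energy conservation make it preserve Boltzmann weights. The output basis `V'` is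
arbitrary and need not diagonalize `X`. -/
theorem excess_le_of_mem_thermalOutputs {X V V' : Matrix (Fin n) (Fin n) ℂ}
    (hX : X ∈ thermalOutputs β E ρ) (hV : V ∈ Matrix.unitaryGroup (Fin n) ℂ)
    (hVE : Commute V (hamiltonian E))
    (h : decohere E ρ = V * Matrix.diagonal (fun i => (η i : ℂ)) * Vᴴ)
    (hV' : V' ∈ Matrix.unitaryGroup (Fin n) ℂ) (hVE' : Commute V' (hamiltonian E)) (t : ℝ) :
    excess β E (fun i => ((V'ᴴ * X * V') i i).re) t ≤ excess β E η t := by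
  obtain ⟨m, F, U, hm, hU, hUE, rfl⟩ := hX
  have : Nonempty (Fin m) := ⟨⟨0, hm⟩⟩
  rw [hamiltonian_add] at hUE
  have hZ := partition_pos β F
  set I : Matrix (Fin m) (Fin m) ℂ := 1
  set W := (V'ᴴ ⊗ₖ I) * U * (V ⊗ₖ I) with hWdef
  have hV'c : V'ᴴ ∈ Matrix.unitaryGroup (Fin n) ℂ := Unitary.star_mem hV'
  have hWu : W ∈ Matrix.unitaryGroup (Fin n × Fin m) ℂ :=
    mul_mem (mul_mem (kronecker_one_mem_unitaryGroup hV'c) hU) (kronecker_one_mem_unitaryGroup hV)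
  have hWE : Commute W (hamiltonian fun x : Fin n × Fin m => E x.1 + F x.2) :=
    ((kronecker_one_commute F (commute_conjTranspose hVE')).mul_left hUE).mul_left
      (kronecker_one_commute F hVE)
  have hW0 := commute_hamiltonian_iff.1 hWE
  have hρ' := decohere_conjugate_eq_diagonal hV hVE h
  have hout : V'ᴴ * partialTrace (U * (ρ ⊗ₖ gibbs β F) * Uᴴ) * V' =
      partialTrace (W * ((Vᴴ * ρ * V) ⊗ₖ gibbs β F) * Wᴴ) := by
    rw [← partialTrace_conjugate]
    congr 1
    have h1 : (V ⊗ₖ I) * ((Vᴴ * ρ * V) ⊗ₖ gibbs β F) * (V ⊗ₖ I)ᴴ = ρ ⊗ₖ gibbs β F := by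
      rw [Matrix.conjTranspose_kronecker, ← Matrix.mul_kronecker_mul, ← Matrix.mul_kronecker_mul,
        cancel_conjugate hV]
      simp [I]
    have h2 : (V'ᴴ ⊗ₖ I)ᴴ = V' ⊗ₖ I := by
      rw [Matrix.conjTranspose_kronecker]
      simp [I]
    rw [← h1, hWdef, Matrix.conjTranspose_mul, Matrix.conjTranspose_mul, h2]
    simp only [Matrix.mul_assoc]
    rfl
  rw [hout]
  simp only [conjugate_diag_re F hWE hρ']
  have hτ : ∀ r, 0 ≤ Real.exp (-β * F r) / partition β F := fun r => by positivity
  refine excess_mulVec_le (fun i j => Finset.sum_nonneg fun s _ => Finset.sum_nonneg fun r _ =>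
    mul_nonneg (Complex.normSq_nonneg _) (hτ r)) (fun j => ?_) (fun i => ?_) t
  · have hcol : ∀ r, ∑ i, ∑ s, Complex.normSq (W (i, s) (j, r)) = 1 := fun r => by
      rw [← sum_normSq_col hWu (j, r), Fintype.sum_prod_type]
    calc ∑ i, ∑ s, ∑ r, Complex.normSq (W (i, s) (j, r)) * (Real.exp (-β * F r) / partition β F)
        = ∑ r, (∑ i, ∑ s, Complex.normSq (W (i, s) (j, r))) *
          (Real.exp (-β * F r) / partition β F) := by
          simp only [Finset.sum_mul]
          symm
          exact Finset.sum_comm.trans (Finset.sum_congr rfl fun i _ => Finset.sum_comm)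
      _ = 1 := by
          simp only [hcol, one_mul]
          rw [← Finset.sum_div]
          exact div_self hZ.ne'
  · have hrow : ∀ s, ∑ x, ∑ r, Complex.normSq (W (i, s) (x, r)) = 1 := fun s => by
      rw [← sum_normSq_row hWu (i, s), Fintype.sum_prod_type]
    -- Wherever the amplitude is nonzero, the product of initial Boltzmann factors equals that of
    -- the final ones, which comes out of the sum over `(x, r)`.
    have hterm : ∀ x s r, Complex.normSq (W (i, s) (x, r)) *
        (Real.exp (-β * F r) / partition β F) * Real.exp (-β * E x) =
        Complex.normSq (W (i, s) (x, r)) *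
          (Real.exp (-β * E i) * Real.exp (-β * F s) / partition β F) := by
      intro x s r
      by_cases hE : E i + F s = E x + F r
      · have : Real.exp (-β * F r) * Real.exp (-β * E x) =
            Real.exp (-β * E i) * Real.exp (-β * F s) := by
          rw [← Real.exp_add, ← Real.exp_add]
          congr 1
          linear_combination β * hE
        rw [← this]
        ring
      · rw [hW0 (i, s) (x, r) hE]
        simp
    simp only [Finset.sum_mul, hterm]
    rw [Finset.sum_comm]
    simp only [← Finset.sum_mul, hrow, one_mul]
    rw [← Finset.sum_div, ← Finset.mul_sum]
    exact mul_div_cancel_right₀ _ hZ.ne'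

/-- Thermal operations do not increase the excess. -/
theorem ThermalConvertible.excess_le {σ : Matrix (Fin n) (Fin n) ℂ} {ζ : Fin n → ℝ}
    (hTO : ThermalConvertible β E ρ σ) (hη : IsPopulation E ρ η) (hζ : IsPopulation E σ ζ) (t : ℝ) :
    excess β E ζ t ≤ excess β E η t := by
  obtain ⟨V, hV, hVE, h⟩ := hη
  obtain ⟨V', hV', hVE', h'⟩ := hζ
  have hcont : Continuous fun X : Matrix (Fin n) (Fin n) ℂ =>
      excess β E (fun i => ((V'ᴴ * X * V') i i).re) t := by
    unfold excess
    refine continuous_finsetSum _ fun i _ => Continuous.max (Continuous.sub ?_ continuous_const)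
      continuous_const
    have : Continuous fun X : Matrix (Fin n) (Fin n) ℂ => V'ᴴ * X * V' := by fun_prop
    exact Complex.continuous_re.comp (this.matrix_elem i i)
  -- All outputs are read in the fixed eigenbasis of the limit `σ`, so the inequality is a closed
  -- condition and passes to the closure.
  have hclosed : IsClosed {X : Matrix (Fin n) (Fin n) ℂ |
      excess β E (fun i => ((V'ᴴ * X * V') i i).re) t ≤ excess β E η t} :=
    isClosed_le hcont continuous_const
  have : excess β E (fun i => ((V'ᴴ * σ * V') i i).re) t ≤ excess β E η t :=
    closure_minimal (fun X hX =>
      excess_le_of_mem_thermalOutputs hX hV hVE h hV' hVE' t) hclosed hTO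
  simpa only [conjugate_apply_self hV' hVE' h', Complex.ofReal_re] using this

end thermal

/-! ### Appending and discarding the ancilla. -/

section ancilla

variable {ι : Type} [DecidableEq ι] {β : ℝ} {a : Fin 2 → ℝ} {E p : ι → ℝ} {c : Config ι}

theorem avg_appendAncilla {ι : Type} (β : ℝ) (a : Fin 2 → ℝ) (c : Config ι) (f : ℝ → ℝ) (x : ι × Fin 2) :
    (appendAncilla β a c).avg f x = c.avg f x.1 * (Real.exp (-β * a x.2) / partition β a) := by
  simp only [appendAncilla, Config.avg]
  rw [Finsupp.sum_mapRange_index (by simp)]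
  simp only [Finsupp.sum, Finset.sum_mul]
  refine Finset.sum_congr rfl fun w _ => ?_
  rw [Matrix.kroneckerMap_apply, gibbs, Matrix.diagonal_apply_eq, Complex.re_mul_ofReal, mul_assoc]

theorem IsClassical.appendAncilla (h : IsClassical E p c) (β : ℝ) (a : Fin 2 → ℝ) :
    IsClassical (fun x => E x.1 + a x.2)
      (fun x => p x.1 * (Real.exp (-β * a x.2) / partition β a)) (appendAncilla β a c) where
  energy_eq := by simp [Thermo.appendAncilla, h.energy_eq]
  diag w := by
    rintro ⟨i, s⟩ ⟨j, r⟩ hij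
    simp only [Thermo.appendAncilla, Finsupp.mapRange_apply, Matrix.kroneckerMap_apply]
    by_cases h1 : i = j
    · have h2 : s ≠ r := fun h2 => hij (by rw [h1, h2])
      rw [gibbs, Matrix.diagonal_apply_ne _ h2, mul_zero]
    · rw [h.diag w h1, zero_mul]
  avg_nonneg f hf x := by
    rw [avg_appendAncilla]
    have := partition_pos β a
    have := h.avg_nonneg f hf x.1
    positivity
  state_eq := by
    have h1 : (Thermo.appendAncilla β a c).state = c.state ⊗ₖ gibbs β a := by
      simp only [Thermo.appendAncilla, Config.state]
      rw [Finsupp.sum_mapRange_index (by simp)]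
      ext x y
      simp [Finsupp.sum, Matrix.sum_apply, Finset.sum_mul]
    rw [h1, h.state_eq, gibbs, Matrix.diagonal_kronecker_diagonal]
    congr 1
    ext x
    push_cast
    rfl

theorem WorkFree.appendAncilla {c : ℕ → Config ι} (h : WorkFree E p c) (β : ℝ) (a : Fin 2 → ℝ) :
    WorkFree (fun x => E x.1 + a x.2) (fun x => p x.1 * (Real.exp (-β * a x.2) / partition β a))
      (fun t => Thermo.appendAncilla β a (c t)) where
  classical t ht := (h.classical t ht).appendAncilla β a
  mean x := by simpa [avg_appendAncilla] using (h.mean x.1).mul_const _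
  sq x := by simpa [avg_appendAncilla] using (h.sq x.1).mul_const _

/-- Discarding the ancilla, the system keeping the energy levels `E`. -/
def discardAncilla (E : ι → ℝ) (c : Config (ι × Fin 2)) : Config ι where
  energy := E
  branch := c.branch.mapRange partialTrace (by ext; simp [partialTrace])

theorem avg_discardAncilla {ι : Type} (E : ι → ℝ) (c : Config (ι × Fin 2)) (f : ℝ → ℝ) (i : ι) :
    (discardAncilla E c).avg f i = c.avg f (i, 0) + c.avg f (i, 1) := by
  simp only [discardAncilla, Config.avg]
  rw [Finsupp.sum_mapRange_index (by simp)]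
  simp [Finsupp.sum, partialTrace, mul_add, Finset.sum_add_distrib]

theorem IsClassical.discardAncilla {E' p : ι × Fin 2 → ℝ} {c : Config (ι × Fin 2)}
    (h : IsClassical E' p c) (E : ι → ℝ) :
    IsClassical E (fun i => p (i, 0) + p (i, 1)) (discardAncilla E c) where
  energy_eq := rfl
  diag w := by
    intro i j hij
    simp only [Thermo.discardAncilla, Finsupp.mapRange_apply, partialTrace, Matrix.of_apply]
    exact Finset.sum_eq_zero fun s _ => h.diag w (by simpa using hij)
  avg_nonneg f hf i := by
    rw [avg_discardAncilla]
    exact add_nonneg (h.avg_nonneg f hf _) (h.avg_nonneg f hf _)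
  state_eq := by
    have h1 : (Thermo.discardAncilla E c).state = partialTrace c.state := by
      simp only [Thermo.discardAncilla, Config.state]
      rw [Finsupp.sum_mapRange_index (by simp)]
      ext i j
      simp only [Finsupp.sum, partialTrace, Matrix.sum_apply, Matrix.of_apply]
      exact Finset.sum_comm
    rw [h1, h.state_eq]
    ext i j
    by_cases hij : i = j <;> simp [partialTrace, Matrix.diagonal_apply, hij]

theorem WorkFree.discardAncilla {E' p : ι × Fin 2 → ℝ} {c : ℕ → Config (ι × Fin 2)}
    (h : WorkFree E' p c) (E : ι → ℝ) :
    WorkFree E (fun i => p (i, 0) + p (i, 1)) (fun t => Thermo.discardAncilla E (c t)) where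
  classical t ht := (h.classical t ht).discardAncilla E
  mean x := by simpa [avg_discardAncilla] using (h.mean (x, 0)).add (h.mean (x, 1))
  sq x := by simpa [avg_discardAncilla] using (h.sq (x, 0)).add (h.sq (x, 1))

theorem workFree_start {p : ι → ℝ} (E : ι → ℝ) (hp : ∀ i, 0 ≤ p i) :
    WorkFree E p fun _ => Config.start E (Matrix.diagonal fun i => (p i : ℂ)) := by
  have havg : ∀ f x, (Config.start E (Matrix.diagonal fun i => (p i : ℂ))).avg f x = f 0 * p x := by
    intro f x
    rw [Config.avg, Config.start, Finsupp.sum_single_index (by simp)]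
    simp
  refine ⟨fun t _ => ⟨rfl, fun w => ?_, fun f hf x => ?_, ?_⟩, fun x => ?_, fun x => ?_⟩
  · rw [Config.start, Finsupp.single_apply]
    split_ifs
    exacts [Matrix.isDiag_diagonal _, Matrix.isDiag_zero]
  · rw [havg]
    exact mul_nonneg (hf _) (hp x)
  · rw [Config.state, Config.start, Finsupp.sum_single_index rfl]
  · simp [havg]
  · simp [havg]

end ancilla

/-! ### Unitaries and the final work statistics. -/

section unitary

variable {ι : Type} [Fintype ι] [DecidableEq ι]

theorem apply_unitary_start (β : ℝ) {m : ℕ} (p : Fin m → ℝ) (U : Fin m → Matrix ι ι ℂ) (E : ι → ℝ)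
    (X : Matrix ι ι ℂ) : (CoarseOp.unitary m p U).apply β (Config.start E X) =
      Config.start E (mixUnitary p U X) := by
  simp [CoarseOp.apply, Config.start]

theorem mixUnitary_one {ι : Type} [Fintype ι] (V X : Matrix ι ι ℂ) :
    mixUnitary (fun _ : Fin 1 => 1) (fun _ => V) X = V * X * Vᴴ := by
  simp [mixUnitary]

/-- The trace of each branch is invariant, so rotating the state away from diagonal form does not
change the distribution of the work. -/
theorem sum_workProb_unitary {V : Matrix ι ι ℂ} (hV : V ∈ Matrix.unitaryGroup ι ℂ) (β : ℝ)
    (c : Config ι) (f : ℝ → ℝ) :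
    ∑ w ∈ ((CoarseOp.unitary 1 (fun _ => 1) fun _ => V).apply β c).branch.support,
      f w * ((CoarseOp.unitary 1 (fun _ => 1) fun _ => V).apply β c).workProb w =
      ∑ x, c.avg f x := by
  rw [← c.sum_support_workProb]
  change (((CoarseOp.unitary 1 (fun _ => 1) fun _ => V).apply β c).branch.sum fun w X =>
    f w * X.trace.re) = c.branch.sum fun w X => f w * X.trace.re
  rw [CoarseOp.apply, Finsupp.sum_mapRange_index (by simp)]
  simp only [mixUnitary_one, Matrix.trace_mul_cycle V,
    show Vᴴ * V = 1 from Matrix.mem_unitaryGroup_iff'.1 hV, Matrix.one_mul]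

theorem state_unitary (V : Matrix ι ι ℂ) (β : ℝ) (c : Config ι) :
    ((CoarseOp.unitary 1 (fun _ => 1) fun _ => V).apply β c).state = V * c.state * Vᴴ := by
  rw [CoarseOp.apply, Config.state, Finsupp.sum_mapRange_index (by simp), Config.state]
  simp only [mixUnitary_one, Finsupp.sum, Matrix.mul_sum, Matrix.sum_mul]

/-- After a final unitary, the work of a family that is asymptotically work-free concentrates at
zero. -/
theorem WorkFree.unitary_statistics {E p : ι → ℝ} {c : ℕ → Config ι} (h : WorkFree E p c)
    (hp : ∑ i, p i = 1) {V : Matrix ι ι ℂ} (hV : V ∈ Matrix.unitaryGroup ι ℂ) (β : ℝ)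
    {c' : ℕ → Config ι}
    (hc' : ∀ t, c' t = (CoarseOp.unitary 1 (fun _ => 1) fun _ => V).apply β (c t)) :
    Tendsto (fun t => (c' t).workMean) atTop (𝓝 0) ∧
      Tendsto (fun t => (c' t).workVariance) atTop (𝓝 0) ∧
      ∀ ε : ℝ, 0 < ε → Tendsto (fun t => (c' t).workTail ε) atTop (𝓝 0) := by
  have hsum : ∀ t f, ∑ w ∈ (c' t).branch.support, f w * (c' t).workProb w =
      ∑ x, (c t).avg f x := fun t f => by
    rw [hc']
    exact sum_workProb_unitary hV β (c t) f
  have hmean : ∀ t, (c' t).workMean = ∑ x, (c t).avg (fun w => w) x := fun t => hsum t fun w => w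
  have hm : Tendsto (fun t => (c' t).workMean) atTop (𝓝 0) := by
    simp only [hmean]
    simpa using tendsto_finsetSum Finset.univ fun x _ => h.mean x
  have hs : Tendsto (fun t => ∑ x, (c t).avg (fun w => w ^ 2) x) atTop (𝓝 0) := by
    simpa using tendsto_finsetSum Finset.univ fun x _ => h.sq x
  refine ⟨hm, ?_, fun ε hε => ?_⟩
  · have hlim := hs.sub (hm.pow 2)
    simp only [ne_eq, OfNat.ofNat_ne_zero, not_false_eq_true, zero_pow, sub_zero] at hlim
    refine hlim.congr' ?_
    filter_upwards [eventually_ge_atTop 1] with t ht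
    have h1 : ∀ x, (c t).avg (fun w => (w - (c' t).workMean) ^ 2) x =
        (c t).avg (fun w => w ^ 2) x + (-2 * (c' t).workMean) * (c t).avg (fun w => w) x +
          (c' t).workMean ^ 2 * (c t).avg (fun _ => 1) x := by
      intro x
      rw [← Config.avg_const_mul, ← Config.avg_const_mul, ← Config.avg_add, ← Config.avg_add]
      congr 1
      ext w
      ring
    have h2 : (c' t).workVariance = ∑ x, (c t).avg (fun w => (w - (c' t).workMean) ^ 2) x :=
      hsum t fun w => (w - (c' t).workMean) ^ 2
    rw [h2]
    simp only [h1, Finset.sum_add_distrib, ← Finset.mul_sum, ← hmean,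
      (h.classical t ht).avg_one, hp]
    ring
  · have htail : ∀ t, (c' t).workTail ε = ∑ x, (c t).avg (fun w => if ε ≤ |w| then 1 else 0) x := by
      intro t
      rw [← hsum, Config.workTail, Finset.sum_filter]
      simp only [ite_mul, one_mul, zero_mul]
    have hlim := hs.const_mul (1 / ε ^ 2)
    rw [mul_zero] at hlim
    refine tendsto_of_tendsto_of_tendsto_of_le_of_le' tendsto_const_nhds hlim ?_ ?_
    · filter_upwards [eventually_ge_atTop 1] with t ht
      rw [htail]
      refine Finset.sum_nonneg fun x _ => (h.classical t ht).avg_nonneg _ (fun w => ?_) x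
      split_ifs <;> simp
    · filter_upwards [eventually_ge_atTop 1] with t ht
      rw [htail, Finset.mul_sum]
      refine Finset.sum_le_sum fun x _ => ?_
      -- Chebyshev: `w² / ε²` dominates the indicator of `ε ≤ |w|` pointwise, and the weights of a
      -- classical configuration are nonnegative.
      have h1 := (h.classical t ht).avg_nonneg
        (fun w => 1 / ε ^ 2 * w ^ 2 + (-1) * if ε ≤ |w| then 1 else 0) (fun w => ?_) x
      · rw [Config.avg_add, Config.avg_const_mul, Config.avg_const_mul] at h1
        linarith
      · split_ifs with hw
        · have h2 : ε ^ 2 ≤ w ^ 2 := by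
            rw [← sq_abs w]
            gcongr
          have h3 : 1 ≤ 1 / ε ^ 2 * w ^ 2 := by
            rw [one_div_mul_eq_div, one_le_div (by positivity)]
            exact h2
          linarith
        · have : 0 ≤ 1 / ε ^ 2 * w ^ 2 := by positivity
          linarith

end unitary

/-! ### Strict domination at the elbows and the protocol. -/

section main

variable {n : ℕ} {β : ℝ} {E η ζ : Fin n → ℝ} {ρ σ : Matrix (Fin n) (Fin n) ℂ}

/-- Curves that meet at the end points only are strictly ordered at the elbows. -/
theorem cum_lt_curveHeight (hTO : ThermalConvertible β E ρ σ)
    (hmeet : thermoCurve β E ρ ∩ thermoCurve β E σ ⊆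
      {((0 : ℝ), (0 : ℝ)), (partition β E, (1 : ℝ))})
    (hη : IsPopulation E ρ η) (hζ : IsPopulation E σ ζ) {π π' : Equiv.Perm (Fin n)}
    (hπ : IsBetaOrder β E η π) (hπ' : IsBetaOrder β E ζ π') {k : ℕ} (h0 : 0 < k) (hk : k < n) :
    cum (ζ ∘ π') k < curveHeight β E η π (cumWeight β E π' k) := by
  have hA0 : 0 < cumWeight β E π' k := by
    rw [← cumWeight_zero (β := β) (E := E) (π := π')]
    exact cum_strictMono (fun i => Real.exp_pos _) h0 (by omega)
  have hA1 : cumWeight β E π' k < partition β E := by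
    rw [← cumWeight_card (β := β) (E := E) (π := π')]
    exact cum_strictMono (fun i => Real.exp_pos _) hk hk
  -- Duality at the tangent slope of the curve of `ρ` gives the inequality. Equality would put an
  -- elbow of `σ` with interior abscissa on the curve of `ρ`.
  refine lt_of_le_of_ne ?_ fun heq => ?_
  · obtain ⟨t, ht⟩ := exists_excess_eq hπ hA0.le hA1
    rw [← ht]
    exact (cum_le_excess ζ t k).trans (by gcongr; exact hTO.excess_le hη hζ t)
  · have h1 := mem_diagonalCurve hπ hA0.le hA1
    have h2 := cum_mem_diagonalCurve hπ' hk
    rw [← heq] at h1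
    rcases hmeet ⟨⟨η, hη, h1⟩, ⟨ζ, hζ, h2⟩⟩ with h | h
    · exact hA0.ne' (congrArg Prod.fst h)
    · exact hA1.ne (congrArg Prod.fst h)

/-- The system and an ancilla can be steered to populations from which Partial Level
Thermalizations on the system lead to the target. -/
theorem exists_steers_ancilla (hβ : 0 < β) (a : Fin 2 → ℝ) {π π' : Equiv.Perm (Fin n)}
    (hπ' : IsBetaOrder β E ζ π') (hsum : ∑ i, η i = ∑ i, ζ i) (l : Fin n)
    (hlt : ∀ k, 0 < k → k < n →
      cum (ζ ∘ π') k < curveHeight β E η π (cumWeight β E π' k)) :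
    ∃ q : Fin n × Fin 2 → ℝ, Steers β (fun x : Fin n × Fin 2 => E x.1 + a x.2)
        (fun x => η x.1 * (Real.exp (-β * a x.2) / partition β a))
        (fun x => E x.1 + a x.2) q ∧
      Steers β E (fun i => q (i, 0) + q (i, 1)) E ζ := by
  obtain ⟨T, hT, hrow, hcol, hcum⟩ := exists_transport β E η π π'
  have hZ := partition_pos β a
  have hZ2 : Real.exp (-β * a 0) + Real.exp (-β * a 1) = partition β a := by
    rw [partition, Fin.sum_univ_two]
  have hpair : ∀ i : Fin n, Real.exp (-β * (E i + a 0)) + Real.exp (-β * (E i + a 1)) =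
      Real.exp (-β * E i) * partition β a := by
    intro i
    rw [← hZ2]
    simp only [mul_add, Real.exp_add]
  -- The two levels over `i` have joint weight `e^{-βE i}` times the partition function of the
  -- ancilla, so the plan is scaled by that partition function.
  obtain ⟨q, hq, hlim⟩ := exists_steers_transport (m := Fin n) (β := β)
    (u₀ := fun x => Real.exp (-β * (E x.1 + a x.2)))
    (p₀ := fun x => η x.1 * (Real.exp (-β * a x.2) / partition β a))
    (D := fun i => Real.exp (-β * E i) * partition β a) (T := fun i j => T i j * partition β a)
    hβ (fun x => Real.exp_pos _) hpair (fun i j => mul_nonneg (hT i j) hZ.le)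
    (fun i => by rw [← Finset.sum_mul, hrow]) (fun j => by rw [← Finset.sum_mul, hcol]) l
  rw [← eq_levels hβ.ne' fun x : Fin n × Fin 2 => E x.1 + a x.2] at hq
  have hη2 : ∀ j, η j * (Real.exp (-β * a 0) / partition β a) +
      η j * (Real.exp (-β * a 1) / partition β a) = η j := by
    intro j
    rw [← mul_add, ← add_div, hZ2, div_self hZ.ne', mul_one]
  have hval : ∀ i, ∑ j, T i j * partition β a * ((η j * (Real.exp (-β * a 0) / partition β a) +
      η j * (Real.exp (-β * a 1) / partition β a)) / (Real.exp (-β * E j) * partition β a)) =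
      ∑ j, T i j * (η j / Real.exp (-β * E j)) := by
    intro i
    refine Finset.sum_congr rfl fun j _ => ?_
    rw [hη2]
    field_simp
  simp only [hval] at hlim
  -- Only finitely many strict inequalities have to survive, so one small `δ` suffices. At `0` and
  -- `n` the cumulative sums agree exactly.
  have hev : ∀ᶠ δ in 𝓝[>] (0 : ℝ), ∀ k ∈ Finset.Ioo 0 n,
      cum (ζ ∘ π') k < cum ((fun i => q δ (i, 0) + q δ (i, 1)) ∘ π') k := by
    rw [eventually_all_finset]
    intro k hk
    rw [Finset.mem_Ioo] at hk
    have h1 : Tendsto (fun δ => cum ((fun i => q δ (i, 0) + q δ (i, 1)) ∘ π') k) (𝓝[>] 0)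
        (𝓝 (curveHeight β E η π (cumWeight β E π' k))) := by
      rw [← hcum k hk.2.le]
      exact tendsto_finsetSum _ fun i _ => hlim (π' i)
    exact h1.eventually (lt_mem_nhds (hlt k hk.1 hk.2))
  obtain ⟨δ, hδ, hδ'⟩ := (hq.and hev).exists
  have hsum' : ∑ i, (q δ (i, 0) + q δ (i, 1)) = ∑ i, ζ i := by
    have := hδ.1
    simp only [Fintype.sum_prod_type, Fin.sum_univ_two, hη2] at this
    rw [this, hsum]
  refine ⟨q δ, hδ, steers_of_cum_le β E ζ hπ' _ hsum' fun k => ?_⟩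
  rcases Nat.eq_zero_or_pos k with rfl | h0
  · simp [cum_zero]
  rcases lt_or_ge k n with hk | hk
  · exact (hδ' k (Finset.mem_Ioo.2 ⟨h0, hk⟩)).le
  · rw [cum_of_le _ hk, cum_of_le _ hk]
    simp only [Function.comp_apply]
    rw [Equiv.sum_comp π' ζ, Equiv.sum_comp π' fun i => q δ (i, 0) + q δ (i, 1), hsum']

end main

end Thermo

end

theorem mainTheorem4 {n : ℕ} (β : ℝ) (hβ : 0 < β) (E : Fin n → ℝ) (a : Fin 2 → ℝ)
    (ρ σ : Matrix (Fin n) (Fin n) ℂ)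
    (hρ : Thermo.IsState ρ) (hσ : Thermo.IsState σ)
    (hblock : Thermo.IsBlockDiagonal E σ)
    (hTO : Thermo.ThermalConvertible β E ρ σ)
    (hmeet : Thermo.thermoCurve β E ρ ∩ Thermo.thermoCurve β E σ =
      {((0 : ℝ), (0 : ℝ)), (Thermo.partition β E, (1 : ℝ))}) :
    Thermo.CoarseConvertibleFree β a E ρ σ := by
  open Thermo in
  obtain ⟨η, hη⟩ := exists_isPopulation (E := E) hρ.1.isHermitian
  obtain ⟨ζ, hζ⟩ := exists_isPopulation (E := E) hσ.1.isHermitian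
  have hη1 := hη.sum_eq_one hρ
  have hζ1 := hζ.sum_eq_one hσ
  have hη0 := hη.nonneg hρ
  have hn : 0 < n := by
    rcases Nat.eq_zero_or_pos n with rfl | h
    · simp at hη1
    · exact h
  obtain ⟨π, hπ⟩ := exists_isBetaOrder β E η
  obtain ⟨π', hπ'⟩ := exists_isBetaOrder β E ζ
  obtain ⟨q, ⟨-, lmid, hlmid, hEmid, Hmid⟩, -, lpost, hlpost, hEpost, Hpost⟩ :=
    exists_steers_ancilla hβ a hπ' (hη1.trans hζ1.symm) ⟨0, hn⟩
      fun k => cum_lt_curveHeight hTO hmeet.subset hη hζ hπ hπ'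
  obtain ⟨V, hV, hVE, hVη⟩ := hη
  obtain ⟨V', hV', hVE', hVζ⟩ := hζ
  obtain ⟨w, U, hw, hw1, hU, hdec⟩ := exists_mixUnitary_eq_decohere E hn
  -- Block-diagonality makes the last rotation end in `σ` itself and not in its dephased version.
  rw [decohere_eq_self hblock] at hVζ
  obtain ⟨M₂, c₂, hc₂, hM₂⟩ := Hmid _ ((workFree_start E hη0).appendAncilla β a)
  obtain ⟨M₃, c₃, hc₃, hM₃⟩ := Hpost _ (hc₂.discardAncilla E)
  have hbound : ∀ i, |E i| ≤ ∑ i, |E i| := fun i =>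
    Finset.single_le_sum (f := fun i => |E i|) (fun i _ => abs_nonneg _) (Finset.mem_univ i)
  set M := max (∑ i, |E i|) (max M₂ M₃) with hM
  have hE : ∀ i, |E i| ≤ M := fun i => (hbound i).trans (le_max_left _ _)
  set c' : ℕ → Config (Fin n) := fun t =>
    (CoarseOp.unitary 1 (fun _ => 1) fun _ => V').apply β (c₃ t) with hc'
  have hVc : Vᴴ ∈ Matrix.unitaryGroup (Fin n) ℂ := Unitary.star_mem hV
  -- Random phases remove the coherences between distinct energies and `Vᴴ` makes the state
  -- diagonal, as level operations require; `V'` finally turns the populations `ζ` into `σ`.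
  refine ⟨⟨[.unitary n w U, .unitary 1 (fun _ => 1) fun _ => Vᴴ], lmid,
    lpost ++ [.unitary 1 (fun _ => 1) fun _ => V'], by simp [Instr.Valid], hlmid, ?_⟩, M, c',
    fun t ht => ⟨?_, ?_, ?_⟩, hc₃.unitary_statistics hζ1 hV' β fun t => rfl⟩
  · intro I hI
    rcases List.mem_append.1 hI with h | h
    · exact (hlpost I h).1
    · rw [List.mem_singleton.1 h]
      trivial
  · refine ⟨Config.start E (Matrix.diagonal fun i => (η i : ℂ)), discardAncilla E (c₂ t), c₂ t,
      ?_, (hM₂ t ht).mono ((le_max_left _ _).trans (le_max_right _ _)), ⟨fun i s => ?_, rfl⟩, ?_⟩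
    · refine ⟨hE, ⟨hw, hw1, hU⟩, hE, ⟨fun _ => zero_le_one, by simp, fun _ =>
        ⟨hVc, commute_conjTranspose hVE⟩⟩, hE, ?_⟩
      rw [apply_unitary_start, apply_unitary_start, hdec, mixUnitary_one, hVη,
        Matrix.conjTranspose_conjTranspose, conjugate_cancel hV]
    · rw [(hc₂.classical t ht).energy_eq]
      rfl
    · have h1 := (hM₃ t ht).mono (M' := M) ((le_max_right _ _).trans (le_max_right _ _))
      have h3 := (hc₃.classical t ht).energy_eq
      unfold Instr.Executes at h1 ⊢
      rw [Instr.compile_append]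
      refine h1.append ⟨by rwa [h3], ⟨fun _ => zero_le_one, by simp, fun _ => ⟨hV', ?_⟩⟩, ?_, rfl⟩
      · rwa [h3]
      · change ∀ i, |(c₃ t).energy i| ≤ M
        rwa [h3]
  · exact (hc₃.classical t ht).energy_eq
  · rw [hc', state_unitary, (hc₃.classical t ht).state_eq, hVζ]
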